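/- All rings are nonzero, commutative and unital. Let $R$ be an integral domain with quotient field $K$. For $R$-submodules $I,J$ of $K$ put $I:J=\{x\in K\mid xJ\subseteq I\}$. An *overring* of $R$ is a ring $T$ with $R\subseteq T\subseteq K$. Let $R'$ and $R^{*}$ denote the integral closure and the complete integral closure of $R$ in $K$; that is, $x\in R^{*}$ if and only if there is a nonzero $r\in R$ with $rx^{n}\in R$ for all $n\ge 0$. The following terminology is used for an integral domain $R$ with quotient field $K$. * $R$ is a *Mori domain* if it satisfies the ascending chain condition on divisorial ideals, i.e. nonzero ideals $I$ of $R$ with $R:(R:I)=I$. * $R$ is a *pseudo-valuation domain* (PVD) if every prime ideal $P$ of $R$ is strongly prime: for all $x,y\in K$ with $xy\in P$, either $x\in P$ or $y\in P$. $R$ is a *locally pseudo-valuation domain* (LPVD) if $R_{M}$ is a PVD for each maximal ideal $M$ of $R$. * $R$ is a *Prüfer domain* if $R_{M}$ is a valuation domain for each maximal ideal $M$ of $R$. * $R$ is a *Dedekind domain* if it is Noetherian, integrally closed and of Krull dimension at most $1$ (fields are included). $R$ is a *Krull domain* if $R$ is the intersection of a (possibly empty) family of discrete valuation rings with quotient field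 $K$ such that each nonzero element of $R$ is a unit in all but finitely many members of the family (the empty intersection is $K$). * $R$ is an *$i$-domain* if the contraction map $\operatorname{Spec}(T)\to\operatorname{Spec}(R)$ is injective for each overring $T$ of $R$. * $R$ is an *$S$-domain* if $PR[X]$ is a height one prime ideal of $R[X]$ whenever $P$ is a height one prime ideal of $R$. A ring $A$ is a *strong $S$-ring* if $A/N$ is an $S$-domain for every prime ideal $N$ of $A$. **Statement.** Let $R$ be a Mori LPVD, i.e. an integral domain that is both a Mori domain and an LPVD. Then the following are equivalent. 1. Each overring of $R$ is a Mori LPVD. 2. Each overring of $R$ is a Mori domain. 3. Each overring of $R$ is an LPVD. 4. $R'=R^{*}$. 5. $R'$ is a Dedekind domain. 6. $R'$ is a Prüfer domain. 7. $R'$ is a Krull domain. 8. $R$ is an $i$-domain. 9. $R$ is a strong $S$-ring. 10. $\dim(R[X])\le 2$, where $\dim$ denotes Krull dimension. -/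

import Mathlib

open scoped Polynomial nonZeroDivisors

/-- An ideal `I` of `R` is divisorial if it is nonzero and `I = R : (R : I)`, the colons
`A : B = {x | x B ⊆ A}` being taken in the quotient field of `R`. -/
def IsDivisorialIdeal {R : Type*} [CommRing R] (I : Ideal R) : Prop :=
  I ≠ ⊥ ∧
    (1 : Submodule R (FractionRing R)) / (1 / IsLocalization.coeSubmodule (FractionRing R) I) =
      IsLocalization.coeSubmodule (FractionRing R) I

/-- A Mori domain: an integral domain with the ascending chain condition on divisorial ideals. -/
def IsMoriDomain (R : Type*) [CommRing R] : Prop :=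
  IsDomain R ∧ WellFoundedGT {I : Ideal R // IsDivisorialIdeal I}

/-- An ideal `I` of `R` is strongly prime if, for `x, y` in the quotient field of `R`,
`x y ∈ I` implies `x ∈ I` or `y ∈ I`. -/
def IsStronglyPrimeIdeal {R : Type*} [CommRing R] (I : Ideal R) : Prop :=
  ∀ x y : FractionRing R, x * y ∈ IsLocalization.coeSubmodule (FractionRing R) I →
    x ∈ IsLocalization.coeSubmodule (FractionRing R) I ∨
      y ∈ IsLocalization.coeSubmodule (FractionRing R) I

/-- A pseudo-valuation domain (PVD): an integral domain all of whose prime ideals are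
strongly prime. -/
def IsPVD (R : Type*) [CommRing R] : Prop :=
  IsDomain R ∧ ∀ P : Ideal R, P.IsPrime → IsStronglyPrimeIdeal P

/-- A locally pseudo-valuation domain (LPVD). -/
def IsLPVD (R : Type*) [CommRing R] : Prop :=
  IsDomain R ∧ ∀ (M : Ideal R) [M.IsMaximal], IsPVD (Localization.AtPrime M)

/-- A Prüfer domain: an integral domain whose localizations at maximal ideals are valuation
domains. -/
def IsPruferDomain (R : Type*) [CommRing R] : Prop :=
  ∃ _ : IsDomain R, ∀ (M : Ideal R) [M.IsMaximal], ValuationRing (Localization.AtPrime M)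

/-- A Krull domain: an integral domain that is the intersection, in its quotient field, of a
family of discrete valuation rings of that field such that every nonzero element of the domain is
a unit in all but finitely many members of the family. (The empty family gives fields.) -/
def IsKrullDomain (R : Type*) [CommRing R] : Prop :=
  ∃ _ : IsDomain R, ∃ F : Set (ValuationSubring (FractionRing R)),
    (∀ V ∈ F, IsDiscreteValuationRing V) ∧
    (∀ x : FractionRing R, x ∈ (algebraMap R (FractionRing R)).range ↔ ∀ V ∈ F, x ∈ V) ∧
    ∀ r : R, r ≠ 0 →
      {V ∈ F | (algebraMap R (FractionRing R) r)⁻¹ ∉ V}.Finite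

/-- An i-domain (with quotient field `K`): for every overring `T` of `R`, i.e. every ring `T` with
`R ⊆ T ⊆ K`, the contraction map `Spec T → Spec R` is injective. -/
def IsIDomain (R K : Type*) [CommRing R] [Field K] [Algebra R K] [IsFractionRing R K] : Prop :=
  ∀ T : Subalgebra R K, Function.Injective (PrimeSpectrum.comap (algebraMap R T))

/-- An S-domain: an integral domain `R` such that `P R[X]` is a height one prime ideal of `R[X]`
for every height one prime ideal `P` of `R`. -/
def IsSDomain (R : Type*) [CommRing R] : Prop :=
  IsDomain R ∧ ∀ P : Ideal R, P.IsPrime → P.height = 1 →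
    (P.map (Polynomial.C : R →+* R[X])).IsPrime ∧
      (P.map (Polynomial.C : R →+* R[X])).height = 1

/-- A strong S-ring: `R / N` is an S-domain for every prime ideal `N` of `R`. -/
def IsStrongSRing (R : Type*) [CommRing R] : Prop :=
  ∀ N : Ideal R, N.IsPrime → IsSDomain (R ⧸ N)

/-! Fix a maximal ideal `M` and put m = M R_M and V = (m : m) inside `K`. Strong primeness of m
makes V a valuation ring with maximal ideal m. The Mori property says that every nonzero ideal has a
finitely generated subideal with the same inverse; combined with V, this makes every nonzero ideal
of `R` principal over V (`StronglyPrimeAt.exists_generator`). Hence nonzero primes of `R` are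
maximal, a nonzero element lies in finitely many of them, and the complete integral closure is
locally equal to V. So R' = R* means exactly that each V is integral over R_M
(`IntegralMultiplierRings`), and this condition is the pivot of the proof.

If it holds, a prime of an overring T lying over `M` must be T ∩ m
(`IntegralMultiplierRings.mem_iff`). Spec T → Spec R is then injective, the localizations of T are
PVDs with the old maximal ideals, and the Mori property can be checked at finitely many `M` at a
time. Moreover R' is Dedekind, hence Prüfer and Krull, and dim R[X] ≤ dim R'[X] ≤ 2.

If it fails, some y in V has residue transcendental over R/M (`ResiduallyTranscendental.coeff_mem`).
Then R_M[y] has a strictly ascending chain of principal ideals and two primes over `M`, the subring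
of values of polynomials without linear term is not an LPVD, and M R[X] has height at least 2. Each
of these contradicts one of the remaining conditions. -/

set_option linter.unusedSectionVars false

/-! ### Pseudo-valuation localizations described inside the quotient field. -/

section LocalizedIdeal

variable {R : Type*} [CommRing R] [IsDomain R]
variable (K : Type*) [Field K] [Algebra R K] [IsFractionRing R K]

/-- The extension of the ideal `P` to the localization at the prime `M`, inside the quotient
field `K`. -/
def localizedIdeal (M P : Ideal R) [hM : M.IsPrime] : Submodule R K where
  carrier := {z | ∃ s ∉ M, ∃ p ∈ P, algebraMap R K s * z = algebraMap R K p}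
  zero_mem' := ⟨1, (Ideal.ne_top_iff_one M).1 hM.ne_top, 0, P.zero_mem, by simp⟩
  add_mem' := by
    rintro a b ⟨s, hs, p, hp, h⟩ ⟨t, ht, q, hq, h'⟩
    refine ⟨s * t, hM.mul_notMem hs ht, t * p + s * q,
      P.add_mem (P.mul_mem_left _ hp) (P.mul_mem_left _ hq), ?_⟩
    simp only [map_mul, map_add, ← h, ← h']
    ring
  smul_mem' := by
    rintro c a ⟨s, hs, p, hp, h⟩
    refine ⟨s, hs, c * p, P.mul_mem_left _ hp, ?_⟩
    rw [map_mul, ← h, Algebra.smul_def]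
    ring

variable {K}

lemma mem_localizedIdeal {M P : Ideal R} [M.IsPrime] {z : K} :
    z ∈ localizedIdeal K M P ↔
      ∃ s ∉ M, ∃ p ∈ P, algebraMap R K s * z = algebraMap R K p := Iff.rfl

lemma isStronglyPrimeIdeal_iff {I : Ideal R} :
    IsStronglyPrimeIdeal I ↔ ∀ x y : K, x * y ∈ IsLocalization.coeSubmodule K I →
      x ∈ IsLocalization.coeSubmodule K I ∨ y ∈ IsLocalization.coeSubmodule K I := by
  let e : FractionRing R ≃ₐ[R] K := FractionRing.algEquiv R K
  have key : ∀ x : FractionRing R, x ∈ IsLocalization.coeSubmodule (FractionRing R) I ↔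
      e x ∈ IsLocalization.coeSubmodule K I := by
    intro x
    simp only [IsLocalization.mem_coeSubmodule]
    refine exists_congr fun a => and_congr_right fun _ => ?_
    rw [← e.injective.eq_iff, e.commutes]
  constructor
  · intro h x y hxy
    have := h (e.symm x) (e.symm y)
    simp only [key, map_mul, AlgEquiv.apply_symm_apply] at this
    exact this hxy
  · intro h x y hxy
    rw [key] at hxy ⊢
    rw [key]
    exact h _ _ (by simpa using hxy)

/-- Primes of R_M correspond to primes of `R` inside `M`, and strong primeness only concerns the
underlying subset of `K`. Localizations of different rings can therefore be compared as subsets of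
`K`. -/
lemma isPVD_localization_iff {M : Ideal R} [M.IsPrime] :
    IsPVD (Localization.AtPrime M) ↔ ∀ P : Ideal R, P.IsPrime → P ≤ M → ∀ x y : K,
      x * y ∈ localizedIdeal K M P → x ∈ localizedIdeal K M P ∨ y ∈ localizedIdeal K M P := by
  let L := Localization.AtPrime M
  have hu : ∀ s : M.primeCompl, IsUnit (algebraMap R K s) := fun s => by
    refine IsUnit.mk0 _ ?_
    rw [Ne, FaithfulSMul.algebraMap_eq_zero_iff]
    exact fun h => s.2 (h ▸ M.zero_mem)
  let : Algebra L K := (IsLocalization.lift hu).toAlgebra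
  have : IsScalarTower R L K := IsScalarTower.of_algebraMap_eq fun x =>
    (IsLocalization.lift_eq hu x).symm
  have : IsFractionRing L K :=
    IsFractionRing.isFractionRing_of_isDomain_of_isLocalization M.primeCompl _ _
  have key : ∀ (I : Ideal L) (z : K), z ∈ IsLocalization.coeSubmodule K I ↔
      z ∈ localizedIdeal K M (I.comap (algebraMap R L)) := by
    intro I z
    rw [IsLocalization.mem_coeSubmodule, mem_localizedIdeal]
    constructor
    · rintro ⟨i, hi, rfl⟩
      obtain ⟨r, s, rfl⟩ := IsLocalization.exists_mk'_eq M.primeCompl i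
      refine ⟨s, s.2, r, ?_, ?_⟩
      · rw [Ideal.mem_comap, ← IsLocalization.mk'_spec L r s]
        exact I.mul_mem_right _ hi
      · rw [IsScalarTower.algebraMap_apply R L K, ← map_mul, IsLocalization.mk'_spec',
          ← IsScalarTower.algebraMap_apply]
    · rintro ⟨s, hs, p, hp, h⟩
      refine ⟨IsLocalization.mk' L p (⟨s, hs⟩ : M.primeCompl), ?_, ?_⟩
      · rw [IsLocalization.mk'_eq_mul_mk'_one]
        exact I.mul_mem_right _ hp
      · refine (hu ⟨s, hs⟩).mul_left_cancel ?_
        rw [h, IsScalarTower.algebraMap_apply R L K, ← map_mul, IsLocalization.mk'_spec',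
          ← IsScalarTower.algebraMap_apply]
  constructor
  · rintro ⟨-, h⟩ P hP hPM x y hxy
    have hd : Disjoint (M.primeCompl : Set R) (P : Set R) :=
      Set.disjoint_left.2 fun a ha ha' => ha (hPM ha')
    have hPr := IsLocalization.isPrime_of_isPrime_disjoint M.primeCompl L P hP hd
    have hc := IsLocalization.under_map_of_isPrime_disjoint M.primeCompl L hP hd
    have := isStronglyPrimeIdeal_iff (K := K).1 (h _ hPr) x y
    simp only [key] at this
    have hc' : (P.map (algebraMap R L)).comap (algebraMap R L) = P := hc
    rw [hc'] at this
    exact this hxy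
  · intro h
    refine ⟨inferInstance, fun P hP => (isStronglyPrimeIdeal_iff (K := K)).2 ?_⟩
    simp only [key]
    refine h _ (hP.comap _) fun r hr => ?_
    by_contra hrM
    exact hP.ne_top (P.eq_top_of_isUnit_mem hr
      (IsLocalization.map_units L (⟨r, hrM⟩ : M.primeCompl)))

end LocalizedIdeal

/-! ### Divisorial ideals and the finitely generated form of the Mori property. -/

section DivisorialClosure

variable {R : Type*} [CommRing R] [IsDomain R]
variable (K : Type*) [Field K] [Algebra R K] [IsFractionRing R K]

/-- `x I ⊆ R`, for `x` in the quotient field. -/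
def MulIntoBase {K : Type*} [Field K] [Algebra R K] (x : K) (I : Ideal R) : Prop :=
  ∀ i ∈ I, x * algebraMap R K i ∈ (algebraMap R K).range

/-- The divisorial closure `R : (R : I)` of an ideal `I`, as an ideal of `R`. -/
def divisorialClosure (I : Ideal R) : Ideal R where
  carrier := {r | ∀ x : K, MulIntoBase x I → x * algebraMap R K r ∈ (algebraMap R K).range}
  zero_mem' := fun x _ => by simp
  add_mem' := fun {a b} ha hb x hx => by
    rw [map_add, mul_add]
    exact add_mem (ha x hx) (hb x hx)
  smul_mem' := fun c a ha x hx => by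
    rw [smul_eq_mul, map_mul, mul_left_comm]
    exact mul_mem ⟨c, rfl⟩ (ha x hx)

variable {K}

lemma mem_divisorialClosure {I : Ideal R} {r : R} : r ∈ divisorialClosure K I ↔
    ∀ x : K, MulIntoBase x I → x * algebraMap R K r ∈ (algebraMap R K).range := Iff.rfl

lemma le_divisorialClosure (I : Ideal R) : I ≤ divisorialClosure K I :=
  fun r hr _ hx => hx r hr

lemma MulIntoBase.mono {x : K} {I J : Ideal R} (h : MulIntoBase x J) (hIJ : I ≤ J) :
    MulIntoBase x I := fun i hi => h i (hIJ hi)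

lemma divisorialClosure_mono {I J : Ideal R} (h : I ≤ J) :
    divisorialClosure K I ≤ divisorialClosure K J :=
  fun _ hr x hx => hr x (hx.mono h)

lemma MulIntoBase.divisorialClosure {x : K} {I : Ideal R} (h : MulIntoBase x I) :
    MulIntoBase x (divisorialClosure K I) := fun _ hi => hi x h

lemma divisorialClosure_eq_of_fractionRing (I : Ideal R) :
    divisorialClosure (FractionRing R) I = divisorialClosure K I := by
  let e : FractionRing R ≃ₐ[R] K := FractionRing.algEquiv R K
  have hr : ∀ (x : FractionRing R) (i : R),
      x * algebraMap R (FractionRing R) i ∈ (algebraMap R (FractionRing R)).range ↔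
        e x * algebraMap R K i ∈ (algebraMap R K).range := by
    intro x i
    simp only [RingHom.mem_range]
    refine exists_congr fun a => ?_
    rw [← e.injective.eq_iff, map_mul, e.commutes, e.commutes]
  ext r
  simp only [mem_divisorialClosure, MulIntoBase]
  rw [e.toEquiv.forall_congr]
  intro x
  simp only [hr]
  rfl

lemma isDivisorialIdeal_iff {I : Ideal R} :
    IsDivisorialIdeal I ↔ I ≠ ⊥ ∧ divisorialClosure K I = I := by
  rw [← divisorialClosure_eq_of_fractionRing, IsDivisorialIdeal]
  refine and_congr_right fun _ => ?_
  set F := FractionRing R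
  have h1 : ∀ x : F, x ∈ 1 / IsLocalization.coeSubmodule F I ↔ MulIntoBase x I := by
    intro x
    rw [Submodule.mem_div_iff_forall_mul_mem]
    simp only [IsLocalization.mem_coeSubmodule, Submodule.mem_one, MulIntoBase, RingHom.mem_range]
    constructor
    · intro h i hi
      exact h _ ⟨i, hi, rfl⟩
    · rintro h _ ⟨i, hi, rfl⟩
      exact h i hi
  have h2 : (1 : Submodule R F) / (1 / IsLocalization.coeSubmodule F I) =
      IsLocalization.coeSubmodule F (divisorialClosure F I) := by
    ext x
    rw [Submodule.mem_div_iff_forall_mul_mem, IsLocalization.mem_coeSubmodule]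
    simp only [h1, Submodule.mem_one]
    constructor
    · intro h
      -- The element 1 lies in R : I, so the double inverse is contained in `R`.
      obtain ⟨r, hr⟩ := h 1 (fun i _ => by simp)
      rw [mul_one] at hr
      refine ⟨r, fun y hy => ?_, hr⟩
      rw [hr, mul_comm]
      exact h y hy
    · rintro ⟨r, hr, rfl⟩ y hy
      rw [mul_comm]
      exact hr y hy
  rw [h2]
  exact (IsLocalization.coeSubmodule_injective F le_rfl).eq_iff

lemma divisorialClosure_isDivisorialIdeal {I : Ideal R} (hI : I ≠ ⊥) :
    IsDivisorialIdeal (divisorialClosure K I) := by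
  rw [isDivisorialIdeal_iff (K := K)]
  refine ⟨fun h => hI (le_bot_iff.1 (h ▸ le_divisorialClosure I)), le_antisymm ?_
    (le_divisorialClosure _)⟩
  exact fun r hr x hx => hr x hx.divisorialClosure

/-- In a Mori domain every nonzero ideal contains a finitely generated ideal with the same
inverse. -/
lemma IsMoriDomain.exists_fg (h : IsMoriDomain R) {I : Ideal R} (hI : I ≠ ⊥) :
    ∃ J ≤ I, J.FG ∧ ∀ x : K, MulIntoBase x J → MulIntoBase x I := by
  obtain ⟨-, hwf⟩ := h
  obtain ⟨a, haI, ha0⟩ := Submodule.exists_mem_ne_zero_of_ne_bot hI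
  let S : Set {I : Ideal R // IsDivisorialIdeal I} :=
    {D | ∃ J ≤ I, J.FG ∧ J ≠ ⊥ ∧ D.1 = divisorialClosure K J}
  have hne : S.Nonempty := by
    have hs : Ideal.span {a} ≠ ⊥ := by simpa using ha0
    exact ⟨⟨_, divisorialClosure_isDivisorialIdeal (K := K) hs⟩, Ideal.span {a},
      by simpa [Ideal.span_le] using haI, ⟨{a}, by simp⟩, hs, rfl⟩
  obtain ⟨D, ⟨J, hJI, hJ, hJ0, hD⟩, hmax⟩ := WellFounded.has_min hwf.wf S hne
  -- By maximality, adjoining `i` to `J` does not enlarge the divisorial closure, so `i` already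
  -- lies in the closure of `J`.
  refine ⟨J, hJI, hJ, fun x hx i hi => ?_⟩
  have hle : J ≤ J ⊔ Ideal.span {i} := le_sup_left
  have h0 : J ⊔ Ideal.span {i} ≠ ⊥ := fun h => hJ0 (le_bot_iff.1 (h ▸ hle))
  let D' : {I : Ideal R // IsDivisorialIdeal I} :=
    ⟨_, divisorialClosure_isDivisorialIdeal (K := K) h0⟩
  have hD' : D' ∈ S := ⟨_, sup_le hJI (by simpa [Ideal.span_le] using hi),
    Submodule.FG.sup hJ ⟨{i}, by simp⟩, h0, rfl⟩
  have hDD : D ≤ D' := by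
    change D.1 ≤ D'.1
    rw [hD]
    exact divisorialClosure_mono hle
  have heq : D = D' := by
    by_contra hne
    exact hmax D' hD' (lt_of_le_of_ne hDD hne)
  have hiD : i ∈ D.1 := by
    rw [heq]
    exact le_divisorialClosure _ (Ideal.mem_sup_right (Ideal.mem_span_singleton_self i))
  rw [hD] at hiD
  exact hiD x hx

/-- Let `I` be the union of a chain of divisorial ideals. The finitely generated `J` lies in some
term; multipliers of that term multiply `J`, hence `I`, into the ring, so every later term lies in
the divisorial closure of that term. -/
lemma isMoriDomain_of_exists_fg
    (h : ∀ I : Ideal R, I ≠ ⊥ → ∃ J ≤ I, J.FG ∧ ∀ x : K, MulIntoBase x J → MulIntoBase x I) :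
    IsMoriDomain R := by
  refine ⟨inferInstance, (wellFoundedGT_iff_monotone_chain_condition).2 fun f => ?_⟩
  let I : Ideal R := ⨆ n, (f n).1
  have hle : ∀ n, (f n).1 ≤ I := fun n => le_iSup (fun n => (f n).1) n
  have hI : I ≠ ⊥ := fun h => (f 0).2.1 (le_bot_iff.1 (h ▸ hle 0))
  obtain ⟨J, hJI, hJ, hx⟩ := h I hI
  have hdir : Directed (· ≤ ·) fun n => (f n).1 := fun a b =>
    ⟨max a b, f.mono (le_max_left a b), f.mono (le_max_right a b)⟩
  obtain ⟨n, hn⟩ : ∃ n, J ≤ (f n).1 := by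
    obtain ⟨s, rfl⟩ := hJ
    have : ∀ t : Finset R, (t : Set R) ⊆ I → ∃ n, (t : Set R) ⊆ (f n).1 := by
      classical
      intro t
      induction t using Finset.induction_on with
      | empty => exact fun _ => ⟨0, by simp⟩
      | insert a t _ ih =>
        intro ht
        rw [Finset.coe_insert, Set.insert_subset_iff] at ht
        obtain ⟨n, hn⟩ := ih ht.2
        obtain ⟨k, hk⟩ := (Submodule.mem_iSup_of_directed _ hdir).1 ht.1
        refine ⟨max n k, ?_⟩
        rw [Finset.coe_insert, Set.insert_subset_iff]
        exact ⟨f.mono (le_max_right n k) hk, hn.trans (f.mono (le_max_left n k))⟩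
    obtain ⟨n, hn⟩ := this s (Ideal.span_le.1 hJI)
    exact ⟨n, Ideal.span_le.2 hn⟩
  refine ⟨n, fun m hnm => le_antisymm (f.mono hnm) ?_⟩
  change (f m).1 ≤ (f n).1
  rw [← ((isDivisorialIdeal_iff (K := K)).1 (f n).2).2]
  exact fun r hr x hxn => hx x (hxn.mono hn) r (hle m hr)

end DivisorialClosure

/-! ### The valuation ring at a prime and its interaction with the Mori property. -/

section LocalTheory

variable {R : Type*} [CommRing R] [IsDomain R]
variable (K : Type*) [Field K] [Algebra R K] [IsFractionRing R K]

/-- The maximal ideal of the localization at the prime `M`, inside the quotient field. -/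
abbrev maxLoc (M : Ideal R) [M.IsPrime] : Submodule R K := localizedIdeal K M M

/-- The ring of multipliers of `maxLoc K M`. -/
def multiplierRing (M : Ideal R) [M.IsPrime] : Subalgebra R K where
  carrier := {x | ∀ z ∈ maxLoc K M, x * z ∈ maxLoc K M}
  mul_mem' := fun {a b} ha hb z hz => by
    rw [mul_assoc]
    exact ha _ (hb z hz)
  add_mem' := fun {a b} ha hb z hz => by
    rw [add_mul]
    exact add_mem (ha z hz) (hb z hz)
  algebraMap_mem' := fun r z hz => by
    rw [← Algebra.smul_def]
    exact Submodule.smul_mem _ _ hz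

/-- The maximal ideal of the localization at `M` is strongly prime. -/
def StronglyPrimeAt (M : Ideal R) [M.IsPrime] : Prop :=
  ∀ x y : K, x * y ∈ maxLoc K M → x ∈ maxLoc K M ∨ y ∈ maxLoc K M

variable {K} {M : Ideal R}

lemma IsLPVD.stronglyPrimeAt (h : IsLPVD R) (M : Ideal R) [M.IsMaximal] : StronglyPrimeAt K M :=
  isPVD_localization_iff.1 (h.2 M) M inferInstance le_rfl

variable [hM : M.IsPrime]

lemma mem_multiplierRing {x : K} :
    x ∈ multiplierRing K M ↔ ∀ z ∈ maxLoc K M, x * z ∈ maxLoc K M := Iff.rfl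

lemma algebraMap_ne_zero_of_notMem {M : Ideal R} {s : R} (hs : s ∉ M) : algebraMap R K s ≠ 0 := by
  rw [Ne, FaithfulSMul.algebraMap_eq_zero_iff]
  exact fun h => hs (h ▸ M.zero_mem)

lemma algebraMap_mem_maxLoc {r : R} : algebraMap R K r ∈ maxLoc K M ↔ r ∈ M := by
  constructor
  · rintro ⟨s, hs, p, hp, h⟩
    rw [← map_mul, (FaithfulSMul.algebraMap_injective R K).eq_iff] at h
    exact (hM.mem_or_mem (h ▸ hp : s * r ∈ M)).resolve_left hs
  · exact fun hr => ⟨1, (Ideal.ne_top_iff_one M).1 hM.ne_top, r, hr, by simp⟩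

lemma one_notMem_maxLoc : (1 : K) ∉ maxLoc K M := by
  rw [← map_one (algebraMap R K), algebraMap_mem_maxLoc]
  exact (Ideal.ne_top_iff_one M).1 hM.ne_top

lemma mem_maxLoc_of_mul {s : R} (hs : s ∉ M) {z : K} (h : algebraMap R K s * z ∈ maxLoc K M) :
    z ∈ maxLoc K M := by
  obtain ⟨t, ht, p, hp, h⟩ := h
  exact ⟨t * s, hM.mul_notMem ht hs, p, hp, by rw [map_mul, mul_assoc, h]⟩

lemma maxLoc_mul_mem {z w : K} (hz : z ∈ maxLoc K M) (hw : w ∈ maxLoc K M) :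
    z * w ∈ maxLoc K M := by
  obtain ⟨s, hs, p, hp, h⟩ := hz
  refine mem_maxLoc_of_mul hs ?_
  rw [← mul_assoc, h, ← Algebra.smul_def]
  exact Submodule.smul_mem _ _ hw

lemma maxLoc_le_multiplierRing {z : K} (hz : z ∈ maxLoc K M) : z ∈ multiplierRing K M :=
  fun _ hw => maxLoc_mul_mem hz hw

lemma mem_multiplierRing_of_mul {s : R} (hs : s ∉ M) {z : K}
    (h : algebraMap R K s * z ∈ multiplierRing K M) : z ∈ multiplierRing K M := by
  intro w hw
  refine mem_maxLoc_of_mul hs ?_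
  rw [← mul_assoc]
  exact h w hw

lemma mem_multiplierRing_of_range {s : R} (hs : s ∉ M) {z : K}
    (h : algebraMap R K s * z ∈ (algebraMap R K).range) : z ∈ multiplierRing K M := by
  obtain ⟨r, hr⟩ := h
  exact mem_multiplierRing_of_mul hs (hr ▸ Subalgebra.algebraMap_mem _ r)

lemma exists_mul_mem_range_of_mem_maxLoc {z : K} (hz : z ∈ maxLoc K M) :
    ∃ s ∉ M, algebraMap R K s * z ∈ (algebraMap R K).range := by
  obtain ⟨s, hs, p, -, h⟩ := hz
  exact ⟨s, hs, p, h.symm⟩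

/-- If z is in m and xz is not, then x⁻¹ · (xz) = z forces x⁻¹ into m. Thus V is a valuation ring
with maximal ideal m. -/
lemma StronglyPrimeAt.inv_mem_maxLoc (h : StronglyPrimeAt K M) {x : K}
    (hx : x ∉ multiplierRing K M) : x⁻¹ ∈ maxLoc K M := by
  rw [mem_multiplierRing] at hx
  push Not at hx
  obtain ⟨z, hz, hxz⟩ := hx
  have hx0 : x ≠ 0 := by
    rintro rfl
    exact hxz (by simp)
  refine (h x⁻¹ (x * z) ?_).resolve_right hxz
  rwa [inv_mul_cancel_left₀ hx0]

lemma StronglyPrimeAt.inv_mem (h : StronglyPrimeAt K M) {x : K} (hx : x ∉ maxLoc K M) :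
    x⁻¹ ∈ multiplierRing K M := by
  by_contra hc
  have := h.inv_mem_maxLoc hc
  rw [inv_inv] at this
  exact hx this

/-- Finitely many generators have a common denominator outside the prime `M`. -/
lemma exists_mulIntoBase_of_fg {J : Ideal R} (hJ : J.FG) (w : K)
    (h : ∀ j ∈ J, ∃ s ∉ M, algebraMap R K s * (w * algebraMap R K j) ∈ (algebraMap R K).range) :
    ∃ s ∉ M, MulIntoBase (algebraMap R K s * w) J := by
  induction J, hJ using Submodule.fg_induction with
  | singleton x =>
    obtain ⟨s, hs, hsx⟩ := h x (Ideal.mem_span_singleton_self x)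
    refine ⟨s, hs, fun i hi => ?_⟩
    obtain ⟨a, rfl⟩ := Ideal.mem_span_singleton'.1 hi
    have : algebraMap R K s * w * algebraMap R K (a * x) =
        algebraMap R K a * (algebraMap R K s * (w * algebraMap R K x)) := by
      rw [map_mul]; ring
    rw [this]
    exact mul_mem ⟨a, rfl⟩ hsx
  | sup J₁ J₂ _ _ h₁ h₂ =>
    obtain ⟨s, hs, hs'⟩ := h₁ fun j hj => h j (Ideal.mem_sup_left hj)
    obtain ⟨t, ht, ht'⟩ := h₂ fun j hj => h j (Ideal.mem_sup_right hj)
    refine ⟨s * t, hM.mul_notMem hs ht, fun i hi => ?_⟩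
    obtain ⟨a, ha, b, hb, rfl⟩ := Submodule.mem_sup.1 hi
    have : algebraMap R K (s * t) * w * algebraMap R K (a + b) =
        algebraMap R K t * (algebraMap R K s * w * algebraMap R K a) +
        algebraMap R K s * (algebraMap R K t * w * algebraMap R K b) := by
      rw [map_mul, map_add]; ring
    rw [this]
    exact add_mem (mul_mem ⟨t, rfl⟩ (hs' a ha)) (mul_mem ⟨s, rfl⟩ (ht' b hb))

lemma StronglyPrimeAt.exists_generator_of_fg (h : StronglyPrimeAt K M) {J : Ideal R}
    (hJ : J.FG) : ∃ b ∈ J, ∀ j ∈ J, ∃ v ∈ multiplierRing K M,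
      algebraMap R K j = v * algebraMap R K b := by
  induction J, hJ using Submodule.fg_induction with
  | singleton x =>
    refine ⟨x, Ideal.mem_span_singleton_self x, fun j hj => ?_⟩
    obtain ⟨a, rfl⟩ := Ideal.mem_span_singleton'.1 hj
    exact ⟨algebraMap R K a, Subalgebra.algebraMap_mem _ _, map_mul _ _ _⟩
  | sup J₁ J₂ _ _ h₁ h₂ =>
    obtain ⟨b, hb, hb'⟩ := h₁
    obtain ⟨c, hc, hc'⟩ := h₂
    have key : (∃ v ∈ multiplierRing K M, algebraMap R K c = v * algebraMap R K b) ∨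
        ∃ v ∈ multiplierRing K M, algebraMap R K b = v * algebraMap R K c := by
      by_cases hb0 : b = 0
      · exact Or.inr ⟨0, zero_mem _, by simp [hb0]⟩
      by_cases hc0 : c = 0
      · exact Or.inl ⟨0, zero_mem _, by simp [hc0]⟩
      have hb0' : algebraMap R K b ≠ 0 := by simpa using hb0
      have hc0' : algebraMap R K c ≠ 0 := by simpa using hc0
      by_cases hV : algebraMap R K c / algebraMap R K b ∈ multiplierRing K M
      · exact Or.inl ⟨_, hV, by field_simp⟩
      · refine Or.inr ⟨_, maxLoc_le_multiplierRing (h.inv_mem_maxLoc hV), ?_⟩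
        field_simp
    rcases key with ⟨v, hv, hcb⟩ | ⟨v, hv, hbc⟩
    · refine ⟨b, Ideal.mem_sup_left hb, fun i hi => ?_⟩
      obtain ⟨x, hx, y, hy, rfl⟩ := Submodule.mem_sup.1 hi
      obtain ⟨u, hu, hu'⟩ := hb' x hx
      obtain ⟨w, hw, hw'⟩ := hc' y hy
      refine ⟨u + w * v, add_mem hu (mul_mem hw hv), ?_⟩
      rw [map_add, hu', hw', hcb]; ring
    · refine ⟨c, Ideal.mem_sup_right hc, fun i hi => ?_⟩
      obtain ⟨x, hx, y, hy, rfl⟩ := Submodule.mem_sup.1 hi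
      obtain ⟨u, hu, hu'⟩ := hb' x hx
      obtain ⟨w, hw, hw'⟩ := hc' y hy
      refine ⟨u * v + w, add_mem (mul_mem hu hv) hw, ?_⟩
      rw [map_add, hu', hw', hbc]; ring

/-- In a Mori domain that is a PVD at `M`, nonzero ideals become principal in the valuation
ring at `M`. -/
lemma StronglyPrimeAt.exists_generator (h : StronglyPrimeAt K M) (hR : IsMoriDomain R)
    {E : Ideal R} (hE : E ≠ ⊥) : ∃ b ∈ E, b ≠ 0 ∧ ∀ c ∈ E,
      algebraMap R K c / algebraMap R K b ∈ multiplierRing K M := by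
  obtain ⟨J, hJE, hJ, hx⟩ := hR.exists_fg (K := K) hE
  obtain ⟨b, hb, hbJ⟩ := h.exists_generator_of_fg (K := K) hJ
  by_cases hall : ∀ c ∈ E, ∃ v ∈ multiplierRing K M, algebraMap R K c = v * algebraMap R K b
  · have hb0 : b ≠ 0 := by
      rintro rfl
      obtain ⟨a, ha, ha0⟩ := Submodule.exists_mem_ne_zero_of_ne_bot hE
      obtain ⟨v, -, hv⟩ := hall a ha
      exact ha0 (by simpa using hv)
    have hb0' : algebraMap R K b ≠ 0 := by simpa using hb0
    refine ⟨b, hJE hb, hb0, fun c hc => ?_⟩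
    obtain ⟨v, hv, hcv⟩ := hall c hc
    rwa [hcv, mul_div_cancel_right₀ _ hb0']
  · push Not at hall
    obtain ⟨c, hc, hcb⟩ := hall
    have hc0 : c ≠ 0 := by
      rintro rfl
      exact hcb 0 (zero_mem _) (by simp)
    have hc0' : algebraMap R K c ≠ 0 := by simpa using hc0
    -- Since c is not in Vb, b/c lies in m and c⁻¹J ⊆ V(b/c) ⊆ m ⊆ R_M. Some s/c with s outside `M`
    -- then multiplies `J`, hence all of `E`, into `R`, so c generates `E` over V.
    have hbc : algebraMap R K b / algebraMap R K c ∈ maxLoc K M := by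
      by_cases hb0 : b = 0
      · simp [hb0]
      have hb0' : algebraMap R K b ≠ 0 := by simpa using hb0
      rw [← inv_div]
      refine h.inv_mem_maxLoc fun hV => hcb _ hV ?_
      field_simp
    obtain ⟨s, hs, hsJ⟩ := exists_mulIntoBase_of_fg (M := M) hJ (algebraMap R K c)⁻¹ (by
      intro j hj
      obtain ⟨v, hv, hjv⟩ := hbJ j hj
      have : (algebraMap R K c)⁻¹ * algebraMap R K j =
        v * (algebraMap R K b / algebraMap R K c) := by rw [hjv]; field_simp
      rw [this]
      exact exists_mul_mem_range_of_mem_maxLoc (hv _ hbc))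
    refine ⟨c, hc, hc0, fun e he => mem_multiplierRing_of_range hs ?_⟩
    have := hx _ hsJ e he
    rwa [mul_assoc, inv_mul_eq_div] at this

/-- Let p generate P over V and take m in M but not in P. If p/m were outside the maximal ideal of
V, a multiple s m² with s outside `M` would lie in pR. So a = s p/m lies in `R` for some such s,
hence in P, and s = (a/p) m falls into `M`. -/
lemma StronglyPrimeAt.eq_of_le (h : StronglyPrimeAt K M) (hR : IsMoriDomain R)
    {P : Ideal R} (hP : P.IsPrime) (hP0 : P ≠ ⊥) (hPM : P ≤ M) : P = M := by
  obtain ⟨p, hp, hp0, hgen⟩ := h.exists_generator (K := K) hR hP0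
  have hp0' : algebraMap R K p ≠ 0 := by simpa using hp0
  refine le_antisymm hPM fun m hm => ?_
  by_contra hmP
  have hm0 : m ≠ 0 := fun h => hmP (h ▸ P.zero_mem)
  have hm0' : algebraMap R K m ≠ 0 := by simpa using hm0
  have hinj := FaithfulSMul.algebraMap_injective R K
  have hq : algebraMap R K p / algebraMap R K m ∈ maxLoc K M := by
    by_contra hq
    obtain ⟨s, hs, a, ha, hsa⟩ := h.inv_mem hq _ (algebraMap_mem_maxLoc.2 hm)
    have : s * (m * m) = p * a := by
      apply hinj
      simp only [map_mul, ← hsa]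
      field_simp
    have hmem : s * (m * m) ∈ P := this ▸ P.mul_mem_right _ hp
    rcases hP.mem_or_mem hmem with h1 | h1
    · exact hs (hPM h1)
    · exact hmP ((hP.mem_or_mem h1).elim id id)
  obtain ⟨s, hs, a, ha, hsa⟩ := hq
  have hsp : a * m = s * p := by
    apply hinj
    simp only [map_mul, ← hsa]
    field_simp
  have haP : a ∈ P :=
    (hP.mem_or_mem (hsp ▸ P.mul_mem_left _ hp : a * m ∈ P)).resolve_right hmP
  have hV := hgen a haP _ (algebraMap_mem_maxLoc.2 hm)
  have : algebraMap R K a / algebraMap R K p * algebraMap R K m = algebraMap R K s := by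
    rw [← hsa]
    field_simp
  rw [this, algebraMap_mem_maxLoc] at hV
  exact hs hV

/-- Locally such an x is the inverse of a generator of m when V = R_M, and any element of V outside
R_M otherwise. A finitely generated subideal with the same inverse makes it global. -/
lemma StronglyPrimeAt.exists_mulIntoBase_notMem (h : StronglyPrimeAt K M)
    (hR : IsMoriDomain R) (hM0 : M ≠ ⊥) :
    ∃ x : K, MulIntoBase x M ∧ ∀ s ∉ M, algebraMap R K s * x ∉ (algebraMap R K).range := by
  obtain ⟨t, ht, ht0, hgen⟩ := h.exists_generator (K := K) hR hM0
  have ht0' : algebraMap R K t ≠ 0 := by simpa using ht0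
  obtain ⟨J, hJM, hJ, hx⟩ := hR.exists_fg (K := K) hM0
  obtain ⟨x, hxM, hxR⟩ : ∃ x : K,
      (∀ j ∈ M, ∃ s ∉ M, algebraMap R K s * (x * algebraMap R K j) ∈ (algebraMap R K).range) ∧
        ∀ s ∉ M, algebraMap R K s * x ∉ (algebraMap R K).range := by
    by_cases hV : ∀ x ∈ multiplierRing K M,
        ∃ s ∉ M, algebraMap R K s * x ∈ (algebraMap R K).range
    · refine ⟨(algebraMap R K t)⁻¹, fun j hj => ?_, ?_⟩
      · rw [inv_mul_eq_div]
        exact hV _ (hgen j hj)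
      · rintro s hs ⟨r, hr⟩
        refine hs ?_
        have : s = r * t := by
          apply FaithfulSMul.algebraMap_injective R K
          rw [map_mul, hr, inv_mul_cancel_right₀ ht0']
        exact this ▸ M.mul_mem_left _ ht
    · push Not at hV
      obtain ⟨x, hx, hx'⟩ := hV
      exact ⟨x, fun j hj => exists_mul_mem_range_of_mem_maxLoc
        (hx _ (algebraMap_mem_maxLoc.2 hj)), hx'⟩
  obtain ⟨s, hs, hsJ⟩ := exists_mulIntoBase_of_fg (M := M) hJ x fun j hj => hxM j (hJM hj)
  refine ⟨_, hx _ hsJ, fun u hu => ?_⟩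
  rw [← mul_assoc, ← map_mul]
  exact hxR _ (hM.mul_notMem hu hs)

/-- The elements r xⁿ generate an ideal `E` of `R` with xE ⊆ E. If b generates `E` over V, then xb
lies in Vb. -/
lemma StronglyPrimeAt.mem_multiplierRing_of_isAlmostIntegral (h : StronglyPrimeAt K M)
    (hR : IsMoriDomain R) {x : K} (hx : IsAlmostIntegral R x) : x ∈ multiplierRing K M := by
  obtain ⟨r, hr, hrx⟩ := hx
  choose c hc using hrx
  let E : Ideal R := Ideal.span (Set.range c)
  have hr0 : r ≠ 0 := nonZeroDivisors.ne_zero hr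
  have hE : E ≠ ⊥ := by
    intro hE
    have h0 : c 0 = 0 := by
      have : c 0 ∈ E := Ideal.subset_span ⟨0, rfl⟩
      rwa [hE, Ideal.mem_bot] at this
    have := hc 0
    rw [h0, pow_zero, Algebra.smul_def, mul_one, map_zero] at this
    exact hr0 ((FaithfulSMul.algebraMap_eq_zero_iff R K).1 this.symm)
  obtain ⟨b, hb, hb0, hgen⟩ := h.exists_generator (K := K) hR hE
  have hb0' : algebraMap R K b ≠ 0 := by simpa using hb0
  have hmul : ∀ e ∈ E, ∃ e' ∈ E, algebraMap R K e' = x * algebraMap R K e := by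
    intro e he
    induction he using Submodule.span_induction with
    | mem e he =>
      obtain ⟨n, rfl⟩ := he
      refine ⟨c (n + 1), Ideal.subset_span ⟨n + 1, rfl⟩, ?_⟩
      rw [hc, hc, Algebra.smul_def, Algebra.smul_def, pow_succ]
      ring
    | zero => exact ⟨0, E.zero_mem, by simp⟩
    | add a b _ _ ha hb =>
      obtain ⟨a', ha', ha⟩ := ha
      obtain ⟨b', hb', hb⟩ := hb
      exact ⟨a' + b', E.add_mem ha' hb', by rw [map_add, map_add, ha, hb, mul_add]⟩
    | smul r a _ ha =>
      obtain ⟨a', ha', ha⟩ := ha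
      refine ⟨r * a', E.mul_mem_left _ ha', ?_⟩
      rw [smul_eq_mul, map_mul, map_mul, ha]
      ring
  obtain ⟨e, he, hxe⟩ := hmul b hb
  have := hgen e he
  rwa [hxe, mul_div_cancel_right₀ _ hb0'] at this

lemma isAlmostIntegral_algebraMap (r : R) : IsAlmostIntegral R (algebraMap R K r) :=
  (completeIntegralClosure R K).algebraMap_mem r

/-- Some z = sy multiplies `M` into `R`, and being in V it maps `M` into itself; hence any nonzero r
in `M` satisfies r zⁿ ∈ M for all n. -/
lemma exists_isAlmostIntegral_mul (hR : IsMoriDomain R) {y : K}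
    (hy : y ∈ multiplierRing K M) : ∃ s ∉ M, IsAlmostIntegral R (algebraMap R K s * y) := by
  by_cases hM0 : M = ⊥
  · obtain ⟨a, b, hb, rfl⟩ := IsFractionRing.div_surjective (A := R) y
    have hb0 := nonZeroDivisors.ne_zero hb
    refine ⟨b, by simpa [hM0] using hb0, ?_⟩
    have hb0' : algebraMap R K b ≠ 0 := by simpa using hb0
    rw [mul_div_cancel₀ _ hb0']
    exact isAlmostIntegral_algebraMap a
  obtain ⟨J, hJM, hJ, hx⟩ := hR.exists_fg (K := K) hM0
  obtain ⟨s, hs, hsJ⟩ := exists_mulIntoBase_of_fg (M := M) hJ y fun j hj =>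
    exists_mul_mem_range_of_mem_maxLoc (hy _ (algebraMap_mem_maxLoc.2 (hJM hj)))
  have hz := hx _ hsJ
  set z := algebraMap R K s * y
  have hzV : z ∈ multiplierRing K M := mul_mem (Subalgebra.algebraMap_mem _ _) hy
  obtain ⟨r, hr, hr0⟩ := Submodule.exists_mem_ne_zero_of_ne_bot hM0
  refine ⟨s, hs, r, mem_nonZeroDivisors_of_ne_zero hr0, fun n => ?_⟩
  suffices ∃ a ∈ M, algebraMap R K a = r • z ^ n by
    obtain ⟨a, -, ha⟩ := this
    exact ⟨a, ha⟩
  induction n with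
  | zero => exact ⟨r, hr, by simp [Algebra.smul_def]⟩
  | succ n ih =>
    obtain ⟨a, ha, ha'⟩ := ih
    obtain ⟨b, hb⟩ := hz a ha
    refine ⟨b, ?_, ?_⟩
    · rw [← algebraMap_mem_maxLoc (K := K), hb]
      exact hzV _ (algebraMap_mem_maxLoc.2 ha)
    · rw [hb, ha', pow_succ, mul_comm z, smul_mul_assoc]

end LocalTheory

/-! ### Finiteness of the set of maximal ideals containing a nonzero element. -/

section FiniteCharacter

variable {R : Type*} [CommRing R] [IsDomain R]

/-- For each maximal M containing t pick x_M in (R : M) outside R_M. The ideal generated by t and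
all t x_M has the same inverse as a finitely generated subideal, which involves only finitely many
M. -/
lemma finite_isMaximal_mem_of_fractionField (K : Type*) [Field K] [Algebra R K]
    [IsFractionRing R K] (hR : IsMoriDomain R) (h : IsLPVD R) {t : R} (ht : t ≠ 0) :
    {M : Ideal R | M.IsMaximal ∧ t ∈ M}.Finite := by
  classical
  set S := {M : Ideal R | M.IsMaximal ∧ t ∈ M}
  have ht0' : algebraMap R K t ≠ 0 := by simpa using ht
  have hex : ∀ M : S, ∃ x : K, MulIntoBase x M.1 ∧
      ∀ s ∉ M.1, algebraMap R K s * x ∉ (algebraMap R K).range := by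
    rintro ⟨M, hM, htM⟩
    exact (h.stronglyPrimeAt (K := K) M).exists_mulIntoBase_notMem hR
      fun h => ht (by simpa [h] using htM)
  choose x hxM hxR using hex
  choose c hc using fun M : S => hxM M t M.2.2
  let E : Ideal R := Ideal.span (insert t (Set.range c))
  have hE : E ≠ ⊥ := fun h0 => ht (by
    have : t ∈ E := Ideal.subset_span (Set.mem_insert _ _)
    rwa [h0, Ideal.mem_bot] at this)
  obtain ⟨J, hJE, hJ, hx⟩ := hR.exists_fg (K := K) hE
  have hfin : ∀ e ∈ E, ∃ F : Finset S, e ∈ Ideal.span (insert t (c '' F)) := by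
    intro e he
    induction he using Submodule.span_induction with
    | mem e he =>
      rcases he with rfl | ⟨M, rfl⟩
      · exact ⟨∅, Ideal.subset_span (Set.mem_insert _ _)⟩
      · exact ⟨{M}, Ideal.subset_span (Or.inr (by simp))⟩
    | zero => exact ⟨∅, zero_mem _⟩
    | add a b _ _ ha hb =>
      obtain ⟨F, hF⟩ := ha
      obtain ⟨G, hG⟩ := hb
      refine ⟨F ∪ G, add_mem (Ideal.span_mono ?_ hF) (Ideal.span_mono ?_ hG)⟩ <;>
        refine Set.insert_subset_insert (Set.image_mono ?_) <;> simp
    | smul r a _ ha =>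
      obtain ⟨F, hF⟩ := ha
      exact ⟨F, Ideal.mul_mem_left _ _ hF⟩
  have hfg : ∀ J : Ideal R, J.FG → J ≤ E →
      ∃ F : Finset S, J ≤ Ideal.span (insert t (c '' F)) := by
    intro J hJ
    induction J, hJ using Submodule.fg_induction with
    | singleton a =>
      intro ha
      obtain ⟨F, hF⟩ := hfin a (ha (Ideal.mem_span_singleton_self a))
      exact ⟨F, by rw [Submodule.span_le]; simpa using hF⟩
    | sup J₁ J₂ _ _ h₁ h₂ =>
      intro h12
      obtain ⟨F, hF⟩ := h₁ (le_sup_left.trans h12)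
      obtain ⟨G, hG⟩ := h₂ (le_sup_right.trans h12)
      refine ⟨F ∪ G, sup_le (hF.trans (Ideal.span_mono ?_)) (hG.trans (Ideal.span_mono ?_))⟩ <;>
        refine Set.insert_subset_insert (Set.image_mono ?_) <;> simp
  obtain ⟨F, hF⟩ := hfg J hJ hJE
  refine ((F : Set S).toFinite.image Subtype.val).subset fun M hM => ?_
  by_contra hMF
  have hMmax : M.IsMaximal := hM.1
  have hle : ¬ F.inf Subtype.val ≤ M := fun hle => by
    obtain ⟨N, hN, hNM⟩ := (Ideal.IsPrime.inf_le' hMmax.isPrime).1 hle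
    exact hMF ⟨N, hN, N.2.1.eq_of_le hMmax.ne_top hNM⟩
  obtain ⟨s, hs, hsM⟩ := Set.not_subset.1 hle
  have hsF : ∀ N ∈ F, s ∈ N.1 := fun N hN => (Finset.inf_le (f := Subtype.val) hN : _ ≤ N.1) hs
  -- Here s lies in every N of `F` but not in M. So s/t multiplies t and each t x_N into `R`, and by
  -- the choice of `J` also t x_M, which puts s x_M in `R`.
  have hsJ : MulIntoBase (algebraMap R K s / algebraMap R K t) J := by
    intro j hj
    have hjF := hF hj
    clear hj
    induction hjF using Submodule.span_induction with
    | mem e he =>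
      rcases he with rfl | ⟨N, hN, rfl⟩
      · exact ⟨s, by field_simp⟩
      · rw [hc]
        obtain ⟨a, ha⟩ := hxM N s (hsF N hN)
        exact ⟨a, by rw [ha]; field_simp⟩
    | zero => simp
    | add a b _ _ ha hb =>
      rw [map_add, mul_add]
      exact add_mem ha hb
    | smul r a _ ha =>
      rw [smul_eq_mul, map_mul, mul_left_comm]
      exact mul_mem ⟨r, rfl⟩ ha
  have hcE : c ⟨M, hM⟩ ∈ E := Ideal.subset_span (Or.inr ⟨_, rfl⟩)
  obtain ⟨a, ha⟩ := hx _ hsJ _ hcE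
  rw [hc] at ha
  refine hxR ⟨M, hM⟩ s hsM ⟨a, ?_⟩
  rw [ha]
  field_simp

lemma IsMoriDomain.finite_isMaximal_mem (hR : IsMoriDomain R) (h : IsLPVD R) {t : R}
    (ht : t ≠ 0) : {M : Ideal R | M.IsMaximal ∧ t ∈ M}.Finite :=
  finite_isMaximal_mem_of_fractionField (FractionRing R) hR h ht

end FiniteCharacter

/-! ### Consequences for overrings when the valuation rings are locally integral. -/

section Overrings

variable {R : Type*} [CommRing R] [IsDomain R]
variable (K : Type*) [Field K] [Algebra R K] [IsFractionRing R K]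

variable (R) in
/-- Locally at every maximal ideal `M`, the ring of multipliers of the maximal ideal is integral
over `R`. -/
def IntegralMultiplierRings : Prop :=
  ∀ (M : Ideal R) [M.IsMaximal], ∀ y ∈ multiplierRing K M,
    ∃ s ∉ M, IsIntegral R (algebraMap R K s * y)

variable {K}

lemma IsMoriDomain.isMaximal (hR : IsMoriDomain R) (h : IsLPVD R) {P : Ideal R}
    (hP : P.IsPrime) (hP0 : P ≠ ⊥) : P.IsMaximal := by
  obtain ⟨M, hM, hPM⟩ := Ideal.exists_le_maximal P hP.ne_top
  rwa [(h.stronglyPrimeAt (K := FractionRing R) M).eq_of_le hR hP hP0 hPM]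

theorem integralClosure_eq_completeIntegralClosure_iff (hR : IsMoriDomain R) (h : IsLPVD R) :
    integralClosure R K = completeIntegralClosure R K ↔ IntegralMultiplierRings R K := by
  constructor
  · intro heq M hM y hy
    obtain ⟨s, hs, hsy⟩ := exists_isAlmostIntegral_mul hR hy
    refine ⟨s, hs, ?_⟩
    rw [← mem_integralClosure_iff R K, heq]
    exact hsy
  · intro hstar
    refine le_antisymm (integralClosure_le_completeIntegralClosure) fun x hx => ?_
    -- The ideal of denominators of x with respect to R'; it is the unit ideal because no maximal
    -- ideal contains it.
    let A : Ideal R := (Subalgebra.toSubmodule (integralClosure R K)).comap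
      (LinearMap.toSpanSingleton R K x)
    have hA : ∀ s : R, s ∈ A ↔ IsIntegral R (algebraMap R K s * x) := fun s => by
      rw [← Algebra.smul_def]
      rfl
    by_cases htop : A = ⊤
    · have h1 : (1 : R) ∈ A := htop ▸ Submodule.mem_top
      rw [hA, map_one, one_mul] at h1
      exact h1
    · obtain ⟨M, hM, hAM⟩ := Ideal.exists_le_maximal A htop
      obtain ⟨s, hs, hsx⟩ := hstar M x
        ((h.stronglyPrimeAt M).mem_multiplierRing_of_isAlmostIntegral hR hx)
      exact absurd (hAM ((hA s).2 hsx)) hs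

instance Subalgebra.isFractionRing_of_isFractionRing (T : Subalgebra R K) :
    IsFractionRing T K := by
  refine IsFractionRing.of_field T K fun z => ?_
  obtain ⟨a, b, -, rfl⟩ := IsFractionRing.div_surjective (A := R) z
  exact ⟨algebraMap R T a, algebraMap R T b, rfl⟩

lemma Subalgebra.exists_algebraMap_mem (T : Subalgebra R K) {I : Ideal T} (hI : I ≠ ⊥) :
    ∃ a : R, a ≠ 0 ∧ algebraMap R T a ∈ I := by
  obtain ⟨q, hq, hq0⟩ := Submodule.exists_mem_ne_zero_of_ne_bot hI
  obtain ⟨a, b, hb, hab⟩ := IsFractionRing.div_surjective (A := R) (q : K)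
  have hb0 : algebraMap R K b ≠ 0 := by simpa using nonZeroDivisors.ne_zero hb
  have hbq : algebraMap R T a = algebraMap R T b * q := by
    apply Subtype.ext
    change algebraMap R K a = algebraMap R K b * q
    rw [← hab, mul_div_cancel₀ _ hb0]
  refine ⟨a, ?_, hbq ▸ I.mul_mem_left _ hq⟩
  rintro rfl
  rw [map_zero, zero_div] at hab
  exact hq0 (Subtype.ext hab.symm)

lemma Subalgebra.comap_ne_bot (T : Subalgebra R K) {I : Ideal T} (hI : I ≠ ⊥) :
    I.comap (algebraMap R T) ≠ ⊥ := fun h => by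
  obtain ⟨a, ha0, ha⟩ := T.exists_algebraMap_mem hI
  exact ha0 (by rwa [← Ideal.mem_comap, h, Ideal.mem_bot] at ha)

variable {T : Subalgebra R K} {Q : Ideal T} {M : Ideal R}

lemma mem_of_mem_maxLoc [hM : M.IsPrime] (hQ : Q.IsPrime) (hQM : Q.comap (algebraMap R T) = M)
    {x : T} (hx : (x : K) ∈ maxLoc K M) : x ∈ Q := by
  obtain ⟨s, hs, p, hp, h⟩ := hx
  subst hQM
  have : algebraMap R T s * x = algebraMap R T p := Subtype.ext h
  exact (hQ.mem_or_mem (this ▸ hp : algebraMap R T s * x ∈ Q)).resolve_left hs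

/-- If x is outside V, then s x⁻¹ = p with p in `M` and s outside it, so s = xp would lie in `Q`. -/
lemma StronglyPrimeAt.mem_of_prime_over [hM : M.IsPrime] (h : StronglyPrimeAt K M)
    (hQM : Q.comap (algebraMap R T) = M) (x : T) :
    (x : K) ∈ multiplierRing K M := by
  by_contra hx
  obtain ⟨s, hs, p, hp, hsp⟩ := h.inv_mem_maxLoc hx
  have hx0 : (x : K) ≠ 0 := fun h0 => hx (h0 ▸ zero_mem _)
  subst hQM
  have : algebraMap R T s = x * algebraMap R T p := by
    apply Subtype.ext
    change algebraMap R K s = x * algebraMap R K p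
    rw [← hsp, mul_left_comm, mul_inv_cancel₀ hx0, mul_one]
  exact hs (this ▸ Q.mul_mem_left _ hp : algebraMap R T s ∈ Q)

/-- The prime ideals of an overring that lie over `M` are all equal to the center of the
valuation ring at `M`. -/
lemma IntegralMultiplierRings.mem_iff [hM : M.IsMaximal] (hstar : IntegralMultiplierRings R K)
    (h : StronglyPrimeAt K M) (hQ : Q.IsPrime) (hQM : Q.comap (algebraMap R T) = M) (x : T) :
    x ∈ Q ↔ (x : K) ∈ maxLoc K M := by
  refine ⟨fun hx => ?_, mem_of_mem_maxLoc hQ hQM⟩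
  by_contra hxm
  obtain ⟨s, hs, p, hp, hpz⟩ := hstar M _ (h.inv_mem hxm)
  have hx0 : (x : K) ≠ 0 := fun h0 => hxm (h0 ▸ zero_mem _)
  have hxQ : algebraMap R T s ^ p.natDegree ∈ Q := by
    have hzx : algebraMap R K s * (x : K)⁻¹ * x = algebraMap R K s := by field_simp
    -- The integral equation of s x⁻¹ multiplied by x to the degree: every term on the right
    -- contains a positive power of x.
    have key : algebraMap R T s ^ p.natDegree = - ∑ i ∈ Finset.range p.natDegree,
        algebraMap R T (p.coeff i) * algebraMap R T s ^ i * x ^ (p.natDegree - i) := by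
      apply Subtype.ext
      have h0 := hpz
      rw [← Polynomial.aeval_def, Polynomial.aeval_eq_sum_range, Finset.sum_range_succ,
        Polynomial.coeff_natDegree, hp, one_smul] at h0
      replace h0 := congrArg (· * (x : K) ^ p.natDegree) h0
      simp only [add_mul, zero_mul, Finset.sum_mul] at h0
      rw [← mul_pow, hzx] at h0
      push_cast
      rw [← sub_eq_zero, sub_neg_eq_add, ← h0, add_comm]
      congr 1
      refine Finset.sum_congr rfl fun i hi => ?_
      have hi' := Finset.mem_range.1 hi
      obtain ⟨k, hk⟩ := Nat.exists_eq_add_of_lt hi'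
      change algebraMap R K (p.coeff i) * algebraMap R K s ^ i * (x : K) ^ (p.natDegree - i) = _
      have h1 : p.natDegree - i = k + 1 := by omega
      rw [h1, Algebra.smul_def]
      nth_rewrite 1 [← hzx]
      have h2 : p.natDegree = i + (k + 1) := by omega
      rw [h2, pow_add, mul_pow (algebraMap R K s * (x : K)⁻¹)]
      ring
    rw [key]
    refine neg_mem (Q.sum_mem fun i hi => Q.mul_mem_left _ ?_)
    have hi' := Finset.mem_range.1 hi
    exact Ideal.pow_mem_of_mem _ hx _ (by omega)
  subst hQM
  exact hs (hQ.mem_of_pow_mem _ hxQ)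

theorem IntegralMultiplierRings.isIDomain (hR : IsMoriDomain R) (h : IsLPVD R)
    (hstar : IntegralMultiplierRings R K) : IsIDomain R K := by
  intro T P₁ P₂ heq
  have heq' : P₁.asIdeal.comap (algebraMap R T) = P₂.asIdeal.comap (algebraMap R T) :=
    congrArg PrimeSpectrum.asIdeal heq
  apply PrimeSpectrum.ext
  by_cases h0 : P₁.asIdeal.comap (algebraMap R T) = ⊥
  · have h1 : P₁.asIdeal = ⊥ := by
      by_contra hc
      exact T.comap_ne_bot hc h0
    have h2 : P₂.asIdeal = ⊥ := by
      by_contra hc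
      exact T.comap_ne_bot hc (heq' ▸ h0)
    rw [h1, h2]
  · have hmax := hR.isMaximal h (P₁.isPrime.comap (algebraMap R T)) h0
    ext x
    rw [hstar.mem_iff (h.stronglyPrimeAt _) P₁.isPrime rfl,
      hstar.mem_iff (h.stronglyPrimeAt _) P₂.isPrime heq'.symm]

/-- Nonzero primes P ≤ Q of T contract to the same maximal ideal of `R`, so both are T ∩ m. Elements
of T outside `Q` are units of V, so P T_Q is m itself as a subset of `K`, and m is strongly prime.
-/
theorem IntegralMultiplierRings.isLPVD (hR : IsMoriDomain R) (h : IsLPVD R)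
    (hstar : IntegralMultiplierRings R K) (T : Subalgebra R K) : IsLPVD T := by
  refine ⟨inferInstance, fun Q hQmax => (isPVD_localization_iff (K := K)).2 ?_⟩
  intro P hP hPQ x y hxy
  by_cases hP0 : P = ⊥
  · subst hP0
    have hbot : ∀ z : K, z ∈ localizedIdeal K Q ⊥ ↔ z = 0 := by
      intro z
      constructor
      · rintro ⟨s, hs, p, hp, h⟩
        rw [(Ideal.mem_bot).1 hp, map_zero] at h
        exact (mul_eq_zero.1 h).resolve_left (algebraMap_ne_zero_of_notMem hs)
      · rintro rfl
        exact zero_mem _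
    rw [hbot] at hxy ⊢
    rw [hbot]
    exact mul_eq_zero.1 hxy
  · have hPc := T.comap_ne_bot hP0
    have hPmax := hR.isMaximal h (hP.comap (algebraMap R T)) hPc
    have hc : Q.comap (algebraMap R T) = P.comap (algebraMap R T) :=
      (hPmax.eq_of_le (hQmax.isPrime.comap _).ne_top (Ideal.comap_mono hPQ)).symm
    have hM := h.stronglyPrimeAt (K := K) (P.comap (algebraMap R T))
    have hQmem := hstar.mem_iff hM hQmax.isPrime hc
    have hPmem := hstar.mem_iff hM hP rfl
    have key : ∀ z : K, z ∈ localizedIdeal K Q P ↔ z ∈ maxLoc K (P.comap (algebraMap R T)) := by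
      intro z
      constructor
      · rintro ⟨s, hs, p, hp, hz⟩
        rw [hQmem] at hs
        rw [hPmem] at hp
        have hs0 : (s : K) ≠ 0 := fun h0 => hs (h0 ▸ zero_mem _)
        have hz' : z = (s : K)⁻¹ * p := by
          rw [eq_inv_mul_iff_mul_eq₀ hs0]
          exact hz
        rw [hz']
        exact hM.inv_mem hs _ hp
      · rintro ⟨s, hs, p, hp, hz⟩
        rw [← hc] at hs
        exact ⟨algebraMap R T s, hs, algebraMap R T p, hp, hz⟩
    rw [key] at hxy ⊢
    rw [key]
    exact hM x y hxy

/-- Let b generate `I` over V. If `I` is not bT locally at `Q`, take c in `I` with c/b outside T_Q.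
When x multiplies b and c into T, the relation (xb)c = (xc)b puts xb in `Q`, hence in m, and then xI
⊆ V(xb) ⊆ m ⊆ R_M. -/
lemma IntegralMultiplierRings.exists_local_fg (hR : IsMoriDomain R)
    (hstar : IntegralMultiplierRings R K) [hM : M.IsMaximal] (h : StronglyPrimeAt K M)
    (hQ : Q.IsPrime) (hQM : Q.comap (algebraMap R T) = M) {I : Ideal T} (hI : I ≠ ⊥) :
    ∃ J ≤ I, J.FG ∧ ∀ x : K, MulIntoBase x J → ∀ i ∈ I, ∃ t ∉ Q,
      algebraMap T K t * (x * algebraMap T K i) ∈ (algebraMap T K).range := by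
  have hTV := h.mem_of_prime_over hQM
  have hmem := hstar.mem_iff h hQ hQM
  obtain ⟨b, hbI, hb0, hb⟩ : ∃ b ∈ I, b ≠ 0 ∧ ∀ i ∈ I, (i : K) / b ∈ multiplierRing K M := by
    by_cases hall : ∀ i ∈ I, (i : K) ∈ maxLoc K M
    · obtain ⟨b, hb, hb0, hgen⟩ := h.exists_generator hR (T.comap_ne_bot hI)
      refine ⟨algebraMap R T b, hb, ?_, fun i hi => ?_⟩
      · rwa [Ne, FaithfulSMul.algebraMap_eq_zero_iff]
      · obtain ⟨s, hs, p, hp, hsp⟩ := hall i hi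
        have hpI : p ∈ I.comap (algebraMap R T) := by
          have : algebraMap R T p = algebraMap R T s * i := Subtype.ext hsp.symm
          rw [Ideal.mem_comap, this]
          exact I.mul_mem_left _ hi
        refine mem_multiplierRing_of_mul hs ?_
        rw [← mul_div_assoc, hsp]
        exact hgen p hpI
    · push Not at hall
      obtain ⟨b, hb, hbm⟩ := hall
      refine ⟨b, hb, fun h0 => hbm (by simp [h0]), fun i _ => ?_⟩
      rw [div_eq_mul_inv]
      exact mul_mem (hTV i) (h.inv_mem hbm)
  have hb0' : (b : K) ≠ 0 := fun h0 => hb0 (Subtype.ext h0)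
  by_cases hall : ∀ i ∈ I, ∃ t ∉ Q, ∃ u : T, t * i = u * b
  · refine ⟨Ideal.span {b}, by simpa [Ideal.span_le] using hbI, ⟨{b}, by simp⟩,
      fun x hx i hi => ?_⟩
    obtain ⟨t, ht, u, hu⟩ := hall i hi
    obtain ⟨w, hw⟩ := hx b (Ideal.mem_span_singleton_self b)
    refine ⟨t, ht, u * w, ?_⟩
    rw [map_mul, hw, mul_left_comm, mul_left_comm (algebraMap T K t), ← map_mul, ← map_mul, hu]
  · push Not at hall
    obtain ⟨c, hc, hcb⟩ := hall
    refine ⟨Ideal.span {b, c}, ?_, Submodule.fg_span (Set.toFinite _), fun x hx i hi => ?_⟩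
    · rw [Ideal.span_le]
      rintro _ (rfl | rfl)
      exacts [hbI, hc]
    obtain ⟨u, hu⟩ := hx b (Ideal.subset_span (by simp))
    obtain ⟨w, hw⟩ := hx c (Ideal.subset_span (by simp))
    have hucw : u * c = w * b := by
      apply Subtype.ext
      change (algebraMap T K u) * (algebraMap T K c) = algebraMap T K w * algebraMap T K b
      rw [hu, hw]
      ring
    have huQ : u ∈ Q := by
      by_contra huQ
      exact hcb u huQ w hucw
    rw [hmem] at huQ
    have hxi : x * (i : K) ∈ maxLoc K M := by
      have : x * (i : K) = (i : K) / b * u := by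
        have hu' : (u : K) = x * b := hu
        rw [hu']
        field_simp
      rw [this]
      exact hb i hi _ huQ
    obtain ⟨s, hs, p, -, hsp⟩ := hxi
    subst hQM
    exact ⟨algebraMap R T s, hs, algebraMap R T p, hsp.symm⟩

/-- The element a of I ∩ R handles the primes of T that do not contain it. The others lie over the
finitely many maximal ideals containing a, and each contributes a finitely generated ideal. -/
theorem IntegralMultiplierRings.isMoriDomain (hR : IsMoriDomain R) (h : IsLPVD R)
    (hstar : IntegralMultiplierRings R K) (T : Subalgebra R K) : IsMoriDomain T := by
  refine isMoriDomain_of_exists_fg (K := K) fun I hI => ?_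
  obtain ⟨a, ha0, haI⟩ := T.exists_algebraMap_mem hI
  have hex : ∀ M : Ideal R, ∃ J ≤ I, J.FG ∧ ∀ Q : Ideal T, Q.IsPrime → M.IsMaximal →
      Q.comap (algebraMap R T) = M → ∀ x : K, MulIntoBase x J → ∀ i ∈ I, ∃ t ∉ Q,
      algebraMap T K t * (x * algebraMap T K i) ∈ (algebraMap T K).range := by
    intro M
    by_cases hM : M.IsMaximal ∧ ∃ Q : Ideal T, Q.IsPrime ∧ Q.comap (algebraMap R T) = M
    · obtain ⟨hM, Q, hQ, hQM⟩ := hM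
      obtain ⟨J, hJI, hJ, hx⟩ := hstar.exists_local_fg hR (h.stronglyPrimeAt M) hQ hQM hI
      refine ⟨J, hJI, hJ, fun Q' hQ' _ hQM' => ?_⟩
      have : Q' = Q := by
        ext x
        rw [hstar.mem_iff (h.stronglyPrimeAt M) hQ hQM,
          hstar.mem_iff (h.stronglyPrimeAt M) hQ' hQM']
      rwa [this]
    · exact ⟨⊥, bot_le, Submodule.fg_bot, fun Q hQ hM' hQM => (hM ⟨hM', Q, hQ, hQM⟩).elim⟩
  choose J hJI hJ hJx using hex
  have hfin := hR.finite_isMaximal_mem h ha0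
  refine ⟨Ideal.span {algebraMap R T a} ⊔ ⨆ M ∈ hfin.toFinset, J M, ?_, ?_, fun x hx i hi => ?_⟩
  · refine sup_le (by simpa [Ideal.span_le] using haI) (iSup₂_le fun M _ => hJI M)
  · exact Submodule.FG.sup ⟨{algebraMap R T a}, by simp⟩ (Submodule.fg_biSup _ _ fun M _ => hJ M)
  let A : Ideal T := ((1 : Submodule T K)).comap
    (LinearMap.toSpanSingleton T K (x * algebraMap T K i))
  have hA : ∀ t : T, t ∈ A ↔
      algebraMap T K t * (x * algebraMap T K i) ∈ (algebraMap T K).range := fun t => by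
    rw [← Algebra.smul_def, RingHom.mem_range, ← Submodule.mem_one]
    rfl
  by_cases htop : A = ⊤
  · have h1 : (1 : T) ∈ A := htop ▸ Submodule.mem_top
    rwa [hA, map_one, one_mul] at h1
  · exfalso
    obtain ⟨Q, hQ, hAQ⟩ := Ideal.exists_le_maximal A htop
    have haQ : algebraMap R T a ∈ Q := by
      refine hAQ ((hA _).2 ?_)
      have hxa := hx _ (Ideal.mem_sup_left (Ideal.mem_span_singleton_self (algebraMap R T a)))
      have : algebraMap T K (algebraMap R T a) * (x * algebraMap T K i) =
          x * algebraMap T K (algebraMap R T a) * algebraMap T K i := by ring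
      rw [this]
      exact mul_mem hxa ⟨i, rfl⟩
    have hM0 : Q.comap (algebraMap R T) ≠ ⊥ := fun h0 => ha0 (by
      rwa [← Ideal.mem_comap, h0, Ideal.mem_bot] at haQ)
    have hMmax := hR.isMaximal h (hQ.isPrime.comap (algebraMap R T)) hM0
    have hle : J (Q.comap (algebraMap R T)) ≤ Ideal.span {algebraMap R T a} ⊔
        ⨆ M ∈ hfin.toFinset, J M :=
      le_sup_of_le_right (le_iSup₂_of_le _ (hfin.mem_toFinset.2 ⟨hMmax, haQ⟩) le_rfl)
    obtain ⟨t, ht, htx⟩ := hJx _ Q hQ.isPrime hMmax rfl x (hx.mono hle) i hi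
    exact ht (hAQ ((hA t).2 htx))

/-- Dimension at most one passes to the integral extension, and by Cohen's theorem only nonzero
primes need finite generation. A prime over `M` is generated by a V-generator t of `M` and an
element s of `M` chosen by prime avoidance. -/
theorem IntegralMultiplierRings.isDedekindDomain (hR : IsMoriDomain R) (h : IsLPVD R)
    (hstar : IntegralMultiplierRings R K) : IsDedekindDomain (integralClosure R K) := by
  have hdim : Ring.DimensionLEOne R := ⟨fun {P} hP0 hP => hR.isMaximal h hP hP0⟩
  have hcl : IsIntegrallyClosed (integralClosure R K) := by
    rw [isIntegrallyClosed_iff K]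
    intro x hx
    exact ⟨⟨x, isIntegral_trans x hx⟩, rfl⟩
  have hno : IsNoetherianRing (integralClosure R K) := by
    refine IsNoetherianRing.of_prime_ne_bot ?_
    set D := integralClosure R K
    intro P hP hP0
    set M := P.comap (algebraMap R D)
    have hM0 : M ≠ ⊥ := D.comap_ne_bot hP0
    have hM : M.IsMaximal := hR.isMaximal h (hP.comap (algebraMap R D)) hM0
    have hsp := h.stronglyPrimeAt (K := K) M
    obtain ⟨t, ht, ht0, hgen⟩ := hsp.exists_generator hR hM0
    have ht0' : algebraMap R K t ≠ 0 := by simpa using ht0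
    have hfin := (hR.finite_isMaximal_mem h ht0).subset
      (Set.sdiff_subset (t := {M}))
    -- With s in `M` outside every other maximal ideal containing t, `M` is the only maximal ideal
    -- of `R` containing both t and s.
    have hns : ¬ ((M : Set R) ⊆ ⋃ L ∈ (hfin.toFinset : Set (Ideal R)), (L : Set R)) := by
      rw [Ideal.subset_union_prime (f := fun L => L) ⊥ ⊥]
      · rintro ⟨L, hL, hML⟩
        have hL' := hfin.mem_toFinset.1 hL
        exact hL'.2 (hM.eq_of_le hL'.1.1.ne_top hML).symm
      · intro L hL _ _
        exact (hfin.mem_toFinset.1 hL).1.1.isPrime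
    obtain ⟨s, hsM, hs⟩ := Set.not_subset.1 hns
    suffices hPe : P = Ideal.span {algebraMap R D t, algebraMap R D s} by
      rw [hPe]
      exact Submodule.fg_span (Set.toFinite _)
    set I : Ideal D := Ideal.span {algebraMap R D t, algebraMap R D s}
    have htI : algebraMap R D t ∈ I := Ideal.subset_span (by simp)
    have hsI : algebraMap R D s ∈ I := Ideal.subset_span (by simp)
    refine le_antisymm (fun x hx => ?_) ?_
    · let B : Ideal R := (I.restrictScalars R).comap (LinearMap.toSpanSingleton R D x)
      have hB : ∀ r : R, r ∈ B ↔ algebraMap R D r * x ∈ I := fun r => by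
        rw [← Algebra.smul_def]
        rfl
      by_cases htop : B = ⊤
      · have h1 : (1 : R) ∈ B := htop ▸ Submodule.mem_top
        rwa [hB, map_one, one_mul] at h1
      · exfalso
        obtain ⟨L, hL, hBL⟩ := Ideal.exists_le_maximal B htop
        have htL : t ∈ L := hBL ((hB t).2 (I.mul_mem_right _ htI))
        have hsL : s ∈ L := hBL ((hB s).2 (I.mul_mem_right _ hsI))
        have hLM : L = M := by
          by_contra hne
          refine hs (Set.mem_biUnion ?_ hsL)
          exact hfin.mem_toFinset.2 ⟨⟨hL, htL⟩, hne⟩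
        rw [hstar.mem_iff hsp hP rfl] at hx
        obtain ⟨a, ha, p, hp, hap⟩ := hx
        obtain ⟨u, hu, hup⟩ := hstar M _ (hgen p hp)
        have hnot : u * a ∉ L := hLM ▸ hM.isPrime.mul_notMem hu ha
        refine hnot (hBL ((hB _).2 ?_))
        have : algebraMap R D (u * a) * x = ⟨_, hup⟩ * algebraMap R D t := by
          apply Subtype.ext
          change algebraMap R K (u * a) * (x : K) = _ * algebraMap R K t
          rw [map_mul, mul_assoc, hap]
          change _ = algebraMap R K u * (algebraMap R K p / algebraMap R K t) * _
          field_simp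
        rw [this]
        exact I.mul_mem_left _ htI
    · rw [Ideal.span_le]
      rintro _ (rfl | rfl)
      exacts [ht, hsM]
  have : IsDedekindRing (integralClosure R K) := { hno, hcl with
    maximalOfPrime := fun {P} h0 h1 => Ring.DimensionLEOne.maximalOfPrime h0 h1 }
  exact {}

end Overrings

/-! ### Dedekind domains are Prüfer and Krull; discrete valuation rings. -/

section Dedekind

variable {D : Type*} [CommRing D]

lemma IsDedekindDomain.isPruferDomain [IsDedekindDomain D] : IsPruferDomain D := by
  refine ⟨inferInstance, fun M hM => ?_⟩
  by_cases hM0 : M = ⊥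
  · subst hM0
    have hD : IsField D := by
      by_contra hD
      exact Ring.ne_bot_of_isMaximal_of_not_isField hM hD rfl
    have hb := hD.localization_map_bijective (M := (⊥ : Ideal D).primeCompl)
      (Rₘ := Localization.AtPrime (⊥ : Ideal D)) (by simp [Ideal.primeCompl])
    have hfield : IsField (Localization.AtPrime (⊥ : Ideal D)) :=
      MulEquiv.isField hD (RingEquiv.ofBijective _ hb).toMulEquiv.symm
    let := hfield.toField
    infer_instance
  · have := IsLocalization.AtPrime.isDiscreteValuationRing_of_dedekind_domain D hM0
      (Localization.AtPrime M)
    infer_instance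

open IsDedekindDomain in
lemma IsDedekindDomain.isKrullDomain [IsDedekindDomain D] : IsKrullDomain D := by
  let K := FractionRing D
  have hmem : ∀ (v : HeightOneSpectrum D) (x : K),
      x ∈ HeightOneSpectrum.valuationSubringAtPrime (R := D) K v ↔ v.valuation K x ≤ 1 := by
    intro v x
    rw [HeightOneSpectrum.valuationSubringAtPrime_eq_valuationSubring]
    rfl
  refine ⟨inferInstance, Set.range (HeightOneSpectrum.valuationSubringAtPrime (R := D) K), ?_, ?_, ?_⟩
  · rintro _ ⟨v, rfl⟩
    exact IsLocalization.AtPrime.isDiscreteValuationRing_of_dedekind_domain D v.ne_bot _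
  · intro x
    constructor
    · rintro ⟨r, rfl⟩ _ ⟨v, rfl⟩
      rw [hmem]
      exact v.valuation_le_one r
    · intro hx
      refine HeightOneSpectrum.mem_integers_of_valuation_le_one K x fun v => ?_
      rw [← hmem]
      exact hx _ ⟨v, rfl⟩
  · intro r _
    refine ((HeightOneSpectrum.Support.finite D (algebraMap D K r)⁻¹).image
      (HeightOneSpectrum.valuationSubringAtPrime K)).subset ?_
    rintro _ ⟨⟨v, rfl⟩, hv⟩
    rw [hmem] at hv
    exact ⟨v, not_le.1 hv, rfl⟩

/-- Otherwise x⁻¹ is in the maximal ideal, and r = (r xⁿ) x⁻ⁿ lies in all its powers, contradicting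
Krull's intersection theorem. -/
lemma ValuationSubring.mem_of_forall_mul_pow_mem {L : Type*} [Field L] (V : ValuationSubring L)
    [IsDiscreteValuationRing V] {r x : L} (hr : r ≠ 0) (h : ∀ n : ℕ, r * x ^ n ∈ V) : x ∈ V := by
  by_contra hx
  have hx0 : x ≠ 0 := fun h0 => hx (h0 ▸ V.zero_mem)
  have hinv : x⁻¹ ∈ V := (V.mem_or_inv_mem x).resolve_left hx
  have hmax : (⟨x⁻¹, hinv⟩ : V) ∈ IsLocalRing.maximalIdeal V := by
    rw [IsLocalRing.mem_maximalIdeal, _root_.mem_nonunits_iff]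
    intro hu
    obtain ⟨w, hw⟩ := hu.exists_right_inv
    have hw' : x⁻¹ * (w : L) = 1 := congrArg Subtype.val hw
    have : x = w := by
      field_simp at hw'
      exact hw'.symm
    exact hx (this ▸ w.2)
  have hr0 := h 0
  rw [pow_zero, mul_one] at hr0
  have hmem : (⟨r, hr0⟩ : V) ∈ ⨅ n : ℕ, IsLocalRing.maximalIdeal V ^ n := by
    rw [Ideal.mem_iInf]
    intro n
    have : (⟨r, hr0⟩ : V) = ⟨_, h n⟩ * ⟨x⁻¹, hinv⟩ ^ n := by
      apply Subtype.ext
      push_cast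
      rw [inv_pow, mul_inv_cancel_right₀ (pow_ne_zero _ hx0)]
    rw [this]
    exact Ideal.mul_mem_left _ _ (Ideal.pow_mem_pow hmax n)
  rw [Ideal.iInf_pow_eq_bot_of_isLocalRing _ Ideal.IsPrime.ne_top', Ideal.mem_bot] at hmem
  exact hr (congrArg Subtype.val hmem)

end Dedekind

/-! ### From a Krull or Prüfer integral closure back to the pivot condition. -/

section IntegralClosure

variable {R : Type*} [CommRing R] [IsDomain R]
variable {K : Type*} [Field K] [Algebra R K] [IsFractionRing R K]

theorem integralClosure_eq_of_isKrullDomain (h : IsKrullDomain (integralClosure R K)) :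
    integralClosure R K = completeIntegralClosure R K := by
  refine le_antisymm (integralClosure_le_completeIntegralClosure) fun x hx => ?_
  obtain ⟨_, F, hF, hmem, -⟩ := h
  set D := integralClosure R K with hD
  let e : FractionRing D ≃ₐ[D] K := FractionRing.algEquiv D K
  obtain ⟨r, hr, hrx⟩ := hx
  have hr0 : algebraMap R D r ≠ 0 := by
    rw [Ne, FaithfulSMul.algebraMap_eq_zero_iff]
    exact nonZeroDivisors.ne_zero hr
  have hxD : e.symm x ∈ (algebraMap D (FractionRing D)).range := by
    rw [hmem]
    intro V hV
    have := hF V hV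
    refine V.mem_of_forall_mul_pow_mem (r := algebraMap D _ (algebraMap R D r)) ?_ fun n => ?_
    · rwa [Ne, FaithfulSMul.algebraMap_eq_zero_iff]
    · refine (hmem _).1 ?_ V hV
      obtain ⟨a, ha⟩ := hrx n
      refine ⟨algebraMap R D a, e.injective ?_⟩
      rw [map_mul, map_pow, e.apply_symm_apply, e.commutes, e.commutes]
      change algebraMap R K a = algebraMap R K r * _
      rw [ha, Algebra.smul_def]
  obtain ⟨d, hd⟩ := hxD
  have : x = d := by
    rw [← e.apply_symm_apply x, ← hd, e.commutes]
    rfl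
  rw [this]
  exact d.2

lemma exists_mul_mem_or_of_valuationRing {A : Type*} [CommRing A] [IsDomain A] [Algebra A K]
    [IsFractionRing A K] (N : Ideal A) [hN : N.IsPrime]
    [ValuationRing (Localization.AtPrime N)] (y : K) :
    (∃ s ∉ N, algebraMap A K s * y ∈ (algebraMap A K).range) ∨
      ∃ s ∉ N, algebraMap A K s * y⁻¹ ∈ (algebraMap A K).range := by
  let L := Localization.AtPrime N
  have hu : ∀ s : N.primeCompl, IsUnit (algebraMap A K s) := fun s =>
    IsUnit.mk0 _ (algebraMap_ne_zero_of_notMem s.2)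
  let : Algebra L K := (IsLocalization.lift hu).toAlgebra
  have : IsScalarTower A L K := IsScalarTower.of_algebraMap_eq fun x =>
    (IsLocalization.lift_eq hu x).symm
  have : IsFractionRing L K :=
    IsFractionRing.isFractionRing_of_isDomain_of_isLocalization N.primeCompl _ _
  have key : ∀ z : K, IsLocalization.IsInteger L z →
      ∃ s ∉ N, algebraMap A K s * z ∈ (algebraMap A K).range := by
    rintro _ ⟨l, rfl⟩
    obtain ⟨a, s, rfl⟩ := IsLocalization.exists_mk'_eq N.primeCompl l
    refine ⟨s, s.2, a, ?_⟩
    rw [IsScalarTower.algebraMap_apply A L K s, ← map_mul, IsLocalization.mk'_spec',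
      ← IsScalarTower.algebraMap_apply]
  exact (ValuationRing.isInteger_or_isInteger L y).imp (key _) (key _)

/-- The center of the ring of multipliers at `M` on an overring contained in it. -/
def centerIdeal (T : Subalgebra R K) (M : Ideal R) [M.IsPrime]
    (hT : T ≤ multiplierRing K M) : Ideal T where
  carrier := {x | (x : K) ∈ maxLoc K M}
  zero_mem' := (maxLoc K M).zero_mem
  add_mem' := fun ha hb => (maxLoc K M).add_mem ha hb
  smul_mem' := fun c _ hx => hT c.2 _ hx

lemma mem_centerIdeal {T : Subalgebra R K} {M : Ideal R} [M.IsPrime]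
    {hT : T ≤ multiplierRing K M} {x : T} : x ∈ centerIdeal T M hT ↔ (x : K) ∈ maxLoc K M :=
  Iff.rfl

lemma StronglyPrimeAt.centerIdeal_isPrime {T : Subalgebra R K} {M : Ideal R} [M.IsPrime]
    (h : StronglyPrimeAt K M) (hT : T ≤ multiplierRing K M) : (centerIdeal T M hT).IsPrime where
  ne_top' := by
    rw [Ideal.ne_top_iff_one, mem_centerIdeal]
    exact one_notMem_maxLoc
  mem_or_mem' := fun hxy => h _ _ hxy

lemma comap_centerIdeal {T : Subalgebra R K} {M : Ideal R} [M.IsPrime]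
    (hT : T ≤ multiplierRing K M) : (centerIdeal T M hT).comap (algebraMap R T) = M := by
  ext r
  rw [Ideal.mem_comap, mem_centerIdeal]
  exact algebraMap_mem_maxLoc

lemma integralClosure_le_multiplierRing (hR : IsMoriDomain R) {M : Ideal R} [M.IsPrime]
    (h : StronglyPrimeAt K M) : integralClosure R K ≤ multiplierRing K M := fun _ hx =>
  h.mem_multiplierRing_of_isAlmostIntegral hR (IsIntegral.isAlmostIntegral hx)

/-- The center of V on R' is contained in `N`, and it is maximal because R' is integral over `R`. -/
lemma StronglyPrimeAt.eq_centerIdeal (hR : IsMoriDomain R) {M : Ideal R} [hM : M.IsMaximal]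
    (h : StronglyPrimeAt K M) {N : Ideal (integralClosure R K)} (hN : N.IsPrime)
    (hNM : N.comap (algebraMap R (integralClosure R K)) = M) :
    N = centerIdeal _ M (integralClosure_le_multiplierRing hR h) := by
  have hprime := h.centerIdeal_isPrime (integralClosure_le_multiplierRing hR h)
  have hc := comap_centerIdeal (integralClosure_le_multiplierRing hR h)
  have hmax : (centerIdeal _ M (integralClosure_le_multiplierRing hR h)).IsMaximal :=
    Ideal.isMaximal_of_isIntegral_of_isMaximal_comap (R := R) _ (hc.symm ▸ hM)
  exact (hmax.eq_of_le hN.ne_top fun x hx => mem_of_mem_maxLoc hN hNM hx).symm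

/-- The valuation ring R'_N at the unique prime N over `M` is dominated by V, hence equal to it. -/
theorem integralMultiplierRings_of_isPruferDomain (hR : IsMoriDomain R) (h : IsLPVD R)
    (hP : IsPruferDomain (integralClosure R K)) : IntegralMultiplierRings R K := by
  intro M hM y hy
  have hsp := h.stronglyPrimeAt (K := K) M
  obtain ⟨_, hP⟩ := hP
  set D := integralClosure R K
  have hDV : D ≤ multiplierRing K M := integralClosure_le_multiplierRing hR hsp
  have hker : RingHom.ker (algebraMap R D) ≤ M := by
    rw [(RingHom.injective_iff_ker_eq_bot _).1 (FaithfulSMul.algebraMap_injective R D)]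
    exact bot_le
  obtain ⟨N, hN, hNM⟩ := Ideal.exists_ideal_over_maximal_of_isIntegral (S := D) M hker
  have hNc := hsp.eq_centerIdeal hR hN.isPrime hNM
  have hNmem : ∀ x : D, x ∈ N ↔ (x : K) ∈ maxLoc K M := fun x => by
    rw [hNc]
    rfl
  have := hP N
  obtain ⟨s, hs, b, hb⟩ : ∃ s ∉ N, algebraMap D K s * y ∈ (algebraMap D K).range := by
    rcases exists_mul_mem_or_of_valuationRing N y with h1 | ⟨s, hs, n, hn⟩
    · exact h1
    · by_cases hy0 : y = 0
      · exact ⟨s, hs, 0, by simp [hy0]⟩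
      have hsn : algebraMap D K s = y * algebraMap D K n := by
        rw [hn, mul_left_comm, mul_inv_cancel₀ hy0, mul_one]
      by_cases hnN : n ∈ N
      · refine (hs ((hNmem s).2 ?_)).elim
        have hs' : (s : K) = y * n := hsn
        rw [hs']
        exact hy _ ((hNmem n).1 hnN)
      · exact ⟨n, hnN, s, by rw [hsn, mul_comm]⟩
  -- The denominator s in R' must be traded for one in `R` outside `M`. If none were a multiple of
  -- s, a prime over `M` would contain s, but `N` is the only one.
  have hcomap : ¬ (Ideal.span {s}).comap (algebraMap R D) ≤ M := fun hle => by
    obtain ⟨Q, hQs, hQ, hQM⟩ := Ideal.exists_ideal_over_prime_of_isIntegral M _ hle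
    have : Q = N := (hsp.eq_centerIdeal hR hQ hQM).trans hNc.symm
    exact hs (this ▸ hQs (Ideal.mem_span_singleton_self s))
  obtain ⟨t, ht, htM⟩ := Set.not_subset.1 hcomap
  obtain ⟨r, hr⟩ := Ideal.mem_span_singleton'.1 (show algebraMap R D t ∈ Ideal.span {s} from ht)
  refine ⟨t, htM, ?_⟩
  have hty : algebraMap R K t * y = ((r * b : D) : K) := by
    have h1 : algebraMap R K t = algebraMap D K r * algebraMap D K s := by
      rw [← map_mul, hr]
      rfl
    have h2 : ((r * b : D) : K) = algebraMap D K r * algebraMap D K b := rfl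
    rw [h1, h2, hb, mul_assoc]
  rw [hty]
  exact (r * b).2

end IntegralClosure

/-! ### Counterexamples built from a residually transcendental element. -/

section ResiduallyTranscendental

variable {R : Type*} [CommRing R] [IsDomain R]
variable {K : Type*} [Field K] [Algebra R K] [IsFractionRing R K]

/-- An element of the ring of multipliers at `M` that is not integral over the localization of
`R` at `M`; its residue is transcendental over the residue field of `M`. -/
def ResiduallyTranscendental (M : Ideal R) [M.IsPrime] (y : K) : Prop :=
  y ∈ multiplierRing K M ∧ ∀ s ∉ M, ¬ IsIntegral R (algebraMap R K s * y)

lemma exists_residuallyTranscendental (h : ¬ IntegralMultiplierRings R K) :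
    ∃ (M : Ideal R) (_ : M.IsMaximal) (y : K), ResiduallyTranscendental M y := by
  unfold IntegralMultiplierRings at h
  push Not at h
  obtain ⟨M, hM, y, hy, hn⟩ := h
  exact ⟨M, hM, y, hy, hn⟩

namespace ResiduallyTranscendental

variable {M : Ideal R} [hM : M.IsPrime] {y : K}

open Polynomial in
/-- A polynomial over `R` whose value at `y` lies in the maximal ideal at `M` has all its
coefficients in `M`. -/
lemma coeff_mem (hy : ResiduallyTranscendental M y) (f : R[X]) (hf : aeval y f ∈ maxLoc K M)
    (i : ℕ) : f.coeff i ∈ M := by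
  induction hn : f.support.card using Nat.strong_induction_on generalizing f with
  | _ n ih =>
  subst hn
  by_cases hf0 : f = 0
  · simp [hf0]
  by_cases hl : f.leadingCoeff ∈ M
  · have hfe : aeval y f.eraseLead ∈ maxLoc K M := by
      have h1 := congrArg (aeval y) f.eraseLead_add_C_mul_X_pow
      rw [map_add, map_mul, aeval_C, map_pow, aeval_X] at h1
      rw [← eq_sub_iff_add_eq] at h1
      rw [h1]
      refine sub_mem hf ?_
      rw [mul_comm]
      exact pow_mem hy.1 f.natDegree _ (algebraMap_mem_maxLoc.2 hl)
    by_cases hi : i = f.natDegree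
    · rwa [hi]
    · rw [← eraseLead_coeff_of_ne i hi]
      exact ih _ (eraseLead_support_card_lt hf0) f.eraseLead hfe rfl
  -- If s f(y) = c with s outside `M`, then s f - c vanishes at y with leading coefficient s · lc(f)
  -- outside `M`, and this coefficient times y is integral.
  · exfalso
    obtain ⟨s, hs, c, hc, hsc⟩ := hf
    rcases Nat.eq_zero_or_pos f.natDegree with h0 | hpos
    · rw [eq_C_of_natDegree_eq_zero h0, aeval_C, ← map_mul,
        (FaithfulSMul.algebraMap_injective R K).eq_iff] at hsc
      rw [leadingCoeff, h0] at hl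
      exact (hM.mul_notMem hs hl) (hsc ▸ hc)
    · have hs0 : s ≠ 0 := fun h => hs (h ▸ M.zero_mem)
      have hdeg : (C c).degree < (C s * f).degree := by
        rw [degree_C_mul hs0]
        exact degree_C_le.trans_lt (natDegree_pos_iff_degree_pos.1 hpos)
      have hroot : aeval y (C s * f - C c) = 0 := by
        rw [map_sub, map_mul, aeval_C, aeval_C, hsc, sub_self]
      have hint := isIntegral_leadingCoeff_smul _ _ hroot
      rw [leadingCoeff_sub_of_degree_lt hdeg, leadingCoeff_mul, leadingCoeff_C,
        Algebra.smul_def] at hint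
      exact hy.2 _ (hM.mul_notMem hs hl) hint

lemma notMem_maxLoc (hy : ResiduallyTranscendental M y) : y ∉ maxLoc K M := fun h => by
  have := hy.coeff_mem Polynomial.X (by rwa [Polynomial.aeval_X]) 1
  rw [Polynomial.coeff_X_one] at this
  exact hM.ne_top ((Ideal.eq_top_iff_one M).2 this)

lemma ne_zero (hy : ResiduallyTranscendental M y) : y ≠ 0 := fun h =>
  hy.notMem_maxLoc (h ▸ zero_mem _)

lemma ne_bot (hy : ResiduallyTranscendental M y) : M ≠ ⊥ := by
  rintro rfl
  obtain ⟨a, b, hb, rfl⟩ := IsFractionRing.div_surjective (A := R) y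
  have hb0 := nonZeroDivisors.ne_zero hb
  have hb0' : algebraMap R K b ≠ 0 := by simpa using hb0
  refine hy.2 b (by simpa using hb0) ?_
  rw [mul_div_cancel₀ _ hb0']
  exact isIntegral_algebraMap

lemma mul_inv_pow_mem (hy : ResiduallyTranscendental M y) (h : StronglyPrimeAt K M) {z : K}
    (hz : z ∈ maxLoc K M) (n : ℕ) : z * y⁻¹ ^ n ∈ maxLoc K M := by
  rw [mul_comm]
  exact pow_mem (h.inv_mem hy.notMem_maxLoc) n _ hz

end ResiduallyTranscendental

/-- The localization at `M` of the ring of values at `y` of the polynomials in `B`. -/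
def localizedValues (M : Ideal R) [hM : M.IsPrime] (y : K) (B : Subalgebra R R[X]) :
    Subalgebra R K where
  carrier := {z | ∃ s ∉ M, ∃ p ∈ B, algebraMap R K s * z = Polynomial.aeval y p}
  mul_mem' := by
    rintro a b ⟨s, hs, p, hp, ha⟩ ⟨t, ht, q, hq, hb⟩
    refine ⟨s * t, hM.mul_notMem hs ht, p * q, mul_mem hp hq, ?_⟩
    rw [map_mul, map_mul, ← ha, ← hb]
    ring
  add_mem' := by
    rintro a b ⟨s, hs, p, hp, ha⟩ ⟨t, ht, q, hq, hb⟩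
    refine ⟨s * t, hM.mul_notMem hs ht, Polynomial.C t * p + Polynomial.C s * q,
      add_mem (mul_mem (B.algebraMap_mem t) hp) (mul_mem (B.algebraMap_mem s) hq), ?_⟩
    rw [map_mul, map_add, map_mul, map_mul, ← ha, ← hb, Polynomial.aeval_C, Polynomial.aeval_C]
    ring
  algebraMap_mem' r := ⟨1, (Ideal.ne_top_iff_one M).1 hM.ne_top, Polynomial.C r,
    B.algebraMap_mem r, by simp⟩

section LocalizedValues

variable {M : Ideal R} [hM : M.IsPrime] {y : K} {B : Subalgebra R R[X]}

lemma mem_localizedValues {z : K} : z ∈ localizedValues M y B ↔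
    ∃ s ∉ M, ∃ p ∈ B, algebraMap R K s * z = Polynomial.aeval y p := Iff.rfl

lemma aeval_mem_localizedValues {p : R[X]} (hp : p ∈ B) :
    Polynomial.aeval y p ∈ localizedValues M y B :=
  ⟨1, (Ideal.ne_top_iff_one M).1 hM.ne_top, p, hp, by simp⟩

lemma maxLoc_le_localizedValues {z : K} (hz : z ∈ maxLoc K M) : z ∈ localizedValues M y B := by
  obtain ⟨s, hs, p, -, h⟩ := hz
  exact ⟨s, hs, Polynomial.C p, B.algebraMap_mem p, by rw [h, Polynomial.aeval_C]⟩

lemma localizedValues_le_multiplierRing (hy : y ∈ multiplierRing K M) :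
    localizedValues M y B ≤ multiplierRing K M := by
  rintro z ⟨s, hs, p, -, h⟩
  refine mem_multiplierRing_of_mul hs ?_
  rw [h]
  have := Subalgebra.aeval_coe (multiplierRing K M) ⟨y, hy⟩ p
  exact this ▸ (Polynomial.aeval (⟨y, hy⟩ : multiplierRing K M) p).2

open Polynomial in
lemma ResiduallyTranscendental.inv_notMem_localizedValues (hy : ResiduallyTranscendental M y) :
    y⁻¹ ∉ localizedValues M y B := by
  rintro ⟨s, hs, p, -, h⟩
  have h0 : aeval y (C s - X * p) = 0 := by
    rw [map_sub, map_mul, aeval_C, aeval_X, ← h, mul_left_comm, mul_inv_cancel₀ hy.ne_zero,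
      mul_one, sub_self]
  have := hy.coeff_mem (C s - X * p) (h0 ▸ zero_mem _) 0
  exact hs (by simpa using this)

end LocalizedValues

/-- Nonzero principal ideals are divisorial, so they satisfy the ascending chain condition. -/
lemma IsMoriDomain.exists_dvd_of_forall_dvd {A : Type*} [CommRing A] [IsDomain A]
    (h : IsMoriDomain A) (a : ℕ → A) (ha0 : ∀ n, a n ≠ 0) (ha : ∀ n, a (n + 1) ∣ a n) :
    ∃ n, a n ∣ a (n + 1) := by
  have hdiv : ∀ n, IsDivisorialIdeal (Ideal.span {a n}) := fun n => by
    rw [isDivisorialIdeal_iff (K := FractionRing A)]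
    have h0 : algebraMap A (FractionRing A) (a n) ≠ 0 := by simpa using ha0 n
    refine ⟨by simpa using ha0 n, le_antisymm (fun r hr => ?_) (le_divisorialClosure _)⟩
    obtain ⟨c, hc⟩ := hr (algebraMap A (FractionRing A) (a n))⁻¹ fun i hi => by
      obtain ⟨c, rfl⟩ := Ideal.mem_span_singleton'.1 hi
      exact ⟨c, by rw [map_mul, mul_comm, mul_inv_cancel_right₀ h0]⟩
    refine Ideal.mem_span_singleton'.2 ⟨c, IsFractionRing.injective A (FractionRing A) ?_⟩
    rw [map_mul, hc, mul_comm, mul_inv_cancel_left₀ h0]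
  have hwf := h.2
  let f : ℕ →o {I : Ideal A // IsDivisorialIdeal I} :=
    ⟨fun n => ⟨_, hdiv n⟩, monotone_nat_of_le_succ fun n =>
      Ideal.span_singleton_le_span_singleton.2 (ha n)⟩
  obtain ⟨n, hn⟩ := wellFoundedGT_iff_monotone_chain_condition.1 hwf f
  have heq : Ideal.span {a n} = Ideal.span {a (n + 1)} :=
    congrArg Subtype.val (hn (n + 1) n.le_succ)
  exact ⟨n, Ideal.span_singleton_le_span_singleton.1 heq.ge⟩

/-- The principal ideals generated by m y⁻ⁿ, for a nonzero m in `M`, ascend because y is in the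
ring, and strictly because y⁻¹ is not. -/
theorem ResiduallyTranscendental.not_isMoriDomain {M : Ideal R} [hM : M.IsPrime] {y : K}
    (hy : ResiduallyTranscendental M y) (h : StronglyPrimeAt K M) (B : Subalgebra R R[X])
    (hX : Polynomial.X ∈ B) : ¬ IsMoriDomain (localizedValues M y B) := by
  intro hMori
  obtain ⟨m, hm, hm0⟩ := Submodule.exists_mem_ne_zero_of_ne_bot hy.ne_bot
  have hm0' : algebraMap R K m ≠ 0 := by simpa using hm0
  have hyT : y ∈ localizedValues M y B := by
    simpa using aeval_mem_localizedValues (M := M) (y := y) hX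
  have hmem : ∀ n : ℕ, algebraMap R K m * y⁻¹ ^ n ∈ localizedValues M y B := fun n =>
    maxLoc_le_localizedValues (hy.mul_inv_pow_mem h (algebraMap_mem_maxLoc.2 hm) n)
  have hne : ∀ n : ℕ, algebraMap R K m * y⁻¹ ^ n ≠ 0 := fun n =>
    mul_ne_zero hm0' (pow_ne_zero _ (inv_ne_zero hy.ne_zero))
  obtain ⟨n, c, hc⟩ := hMori.exists_dvd_of_forall_dvd (fun n => ⟨_, hmem n⟩)
    (fun n h0 => hne n (congrArg Subtype.val h0))
    (fun n => ⟨⟨y, hyT⟩, Subtype.ext (by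
      change _ = algebraMap R K m * y⁻¹ ^ (n + 1) * y
      rw [pow_succ, mul_assoc, mul_assoc, inv_mul_cancel₀ hy.ne_zero, mul_one])⟩)
  have hc' : algebraMap R K m * y⁻¹ ^ (n + 1) = algebraMap R K m * y⁻¹ ^ n * c :=
    congrArg Subtype.val hc
  rw [pow_succ, ← mul_assoc] at hc'
  exact hy.inv_notMem_localizedValues ((mul_left_cancel₀ (hne n) hc') ▸ c.2)

theorem integralMultiplierRings_of_isMoriDomain (h : IsLPVD R)
    (hT : ∀ T : Subalgebra R K, IsMoriDomain T) : IntegralMultiplierRings R K := by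
  by_contra hc
  obtain ⟨M, hM, y, hy⟩ := exists_residuallyTranscendental hc
  exact hy.not_isMoriDomain (h.stronglyPrimeAt M) ⊤ Algebra.mem_top (hT _)

/-- A proper ideal of an overring `T` that contains all elements of `maxLoc K M` in `T` contracts
to `M`. -/
lemma comap_eq_of_forall_mem {M : Ideal R} [hM : M.IsMaximal] {T : Subalgebra R K} {Q : Ideal T}
    (hQ : Q ≠ ⊤) (hle : ∀ z : T, (z : K) ∈ maxLoc K M → z ∈ Q) :
    Q.comap (algebraMap R T) = M :=
  (hM.eq_of_le (Ideal.comap_ne_top _ hQ) fun m hm =>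
    hle (algebraMap R T m) (algebraMap_mem_maxLoc.2 hm)).symm

/-- In T = R_M[y] both the center of V and any maximal ideal containing the nonunit y lie over `M`;
the first omits y. -/
theorem integralMultiplierRings_of_isIDomain (h : IsLPVD R) (hI : IsIDomain R K) :
    IntegralMultiplierRings R K := by
  by_contra hc
  obtain ⟨M, hM, y, hy⟩ := exists_residuallyTranscendental hc
  have hsp := h.stronglyPrimeAt (K := K) M
  let T : Subalgebra R K := localizedValues M y ⊤
  have hT : T ≤ multiplierRing K M := localizedValues_le_multiplierRing hy.1
  have hyT : y ∈ T := by
    simpa using aeval_mem_localizedValues (M := M) (y := y) (Algebra.mem_top (x := Polynomial.X))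
  have hne : Ideal.span {(⟨y, hyT⟩ : T)} ≠ ⊤ := by
    rw [Ne, Ideal.span_singleton_eq_top]
    intro hu
    obtain ⟨w, hw⟩ := hu.exists_right_inv
    have hw' : y * (w : K) = 1 := congrArg Subtype.val hw
    exact hy.inv_notMem_localizedValues ((inv_eq_of_mul_eq_one_right hw') ▸ w.2)
  obtain ⟨Q, hQ, hyQ⟩ := Ideal.exists_le_maximal _ hne
  have hyQ' : (⟨y, hyT⟩ : T) ∈ Q := hyQ (Ideal.mem_span_singleton_self _)
  have hQM : Q.comap (algebraMap R T) = M := by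
    refine comap_eq_of_forall_mem hQ.ne_top fun z hz => ?_
    have hz' : (z : K) * y⁻¹ ∈ T := by
      simpa using maxLoc_le_localizedValues (hy.mul_inv_pow_mem hsp hz 1)
    have : z = ⟨_, hz'⟩ * ⟨y, hyT⟩ := Subtype.ext (by
      change (z : K) = z * y⁻¹ * y
      rw [inv_mul_cancel_right₀ hy.ne_zero])
    rw [this]
    exact Q.mul_mem_left _ hyQ'
  have heq := @hI T ⟨_, hsp.centerIdeal_isPrime hT⟩ ⟨Q, hQ.isPrime⟩
    (PrimeSpectrum.ext ((comap_centerIdeal hT).trans hQM.symm))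
  have heq' : centerIdeal T M hT = Q := congrArg PrimeSpectrum.asIdeal heq
  rw [← heq'] at hyQ'
  exact hy.notMem_maxLoc hyQ'

variable (R) in
/-- The polynomials without linear term. -/
def noLinearTerm : Subalgebra R R[X] where
  carrier := {p | p.coeff 1 = 0}
  mul_mem' := fun {a b} ha hb => by
    rw [Set.mem_ofPred_eq] at *
    rw [Polynomial.mul_coeff_one, ha, hb, mul_zero, zero_mul, add_zero]
  add_mem' := fun {a b} ha hb => by
    rw [Set.mem_ofPred_eq] at *
    rw [Polynomial.coeff_add, ha, hb, add_zero]
  algebraMap_mem' := fun r => by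
    rw [Set.mem_ofPred_eq, Polynomial.algebraMap_apply, Polynomial.coeff_C_of_ne_zero one_ne_zero]

lemma mem_noLinearTerm {p : R[X]} : p ∈ noLinearTerm R ↔ p.coeff 1 = 0 := Iff.rfl

open Polynomial in
-- The ring has a cusp: y is missing, but some maximal `Q` contains y² and y³. Strong primeness at
-- `Q` would put y in Q T_Q, so uy = q with u outside `Q`; comparing linear coefficients shows that
-- u lies in `Q` after all.
theorem ResiduallyTranscendental.not_isLPVD {M : Ideal R} [hM : M.IsMaximal] {y : K}
    (hy : ResiduallyTranscendental M y) (h : StronglyPrimeAt K M) :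
    ¬ IsLPVD (localizedValues M y (noLinearTerm R)) := by
  intro hL
  set T := localizedValues M y (noLinearTerm R)
  have hpow : ∀ n : ℕ, n ≠ 1 → y ^ n ∈ T := fun n hn => by
    have : (X : R[X]) ^ n ∈ noLinearTerm R := by
      rw [mem_noLinearTerm, coeff_X_pow, if_neg hn.symm]
    simpa using aeval_mem_localizedValues (M := M) (y := y) this
  let y2 : T := ⟨y ^ 2, hpow 2 (by norm_num)⟩
  let y3 : T := ⟨y ^ 3, hpow 3 (by norm_num)⟩
  have hne : Ideal.span {y2, y3} ≠ ⊤ := by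
    rw [Ideal.ne_top_iff_one, Ideal.mem_span_pair]
    rintro ⟨a, b, hab⟩
    obtain ⟨s, hs, p, -, hp⟩ := a.2
    obtain ⟨t, ht, q, -, hq⟩ := b.2
    have hab' : (a : K) * y ^ 2 + b * y ^ 3 = 1 := congrArg Subtype.val hab
    have h0 : aeval y (C (s * t) - (C t * p * X ^ 2 + C s * q * X ^ 3)) = 0 := by
      simp only [map_sub, map_add, map_mul, aeval_C, aeval_X, map_pow, ← hp, ← hq]
      linear_combination (-(algebraMap R K s * algebraMap R K t)) * hab'
    have h1 := hy.coeff_mem _ (h0 ▸ zero_mem _) 0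
    refine hM.isPrime.mul_notMem hs ht ?_
    simpa [coeff_zero_eq_eval_zero] using h1
  obtain ⟨Q, hQ, hyQ⟩ := Ideal.exists_le_maximal _ hne
  have hy2 : y2 ∈ Q := hyQ (Ideal.subset_span (by simp))
  have hy3 : y3 ∈ Q := hyQ (Ideal.subset_span (by simp))
  have hmQ : ∀ z : T, (z : K) ∈ maxLoc K M → z ∈ Q := fun z hz => by
    have hz' : (z : K) * y⁻¹ ^ 2 ∈ T := maxLoc_le_localizedValues (hy.mul_inv_pow_mem h hz 2)
    have : z = ⟨_, hz'⟩ * y2 := Subtype.ext (by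
      change (z : K) = z * y⁻¹ ^ 2 * y ^ 2
      rw [mul_assoc, ← mul_pow, inv_mul_cancel₀ hy.ne_zero, one_pow, mul_one])
    rw [this]
    exact Q.mul_mem_left _ hy2
  have hQM := comap_eq_of_forall_mem hQ.ne_top hmQ
  have hyy : y * y ∈ maxLoc K Q :=
    ⟨1, (Ideal.ne_top_iff_one Q).1 hQ.ne_top, y2, hy2, by
      rw [map_one, one_mul, ← sq]
      rfl⟩
  obtain ⟨u, hu, q, -, huq⟩ : y ∈ maxLoc K Q := (hL.stronglyPrimeAt Q _ _ hyy).elim id id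
  have huq' : (u : K) * y = q := huq
  obtain ⟨s, hs, p, hpB, hp⟩ := u.2
  obtain ⟨t, ht, r, hrB, hr⟩ := q.2
  rw [mem_noLinearTerm] at hpB hrB
  have hp0 : p.coeff 0 ∈ M := by
    have h0 : aeval y (C t * p * X - C s * r) = 0 := by
      simp only [map_sub, map_mul, aeval_C, aeval_X, ← hp, ← hr]
      linear_combination (algebraMap R K s * algebraMap R K t) * huq'
    have h1 := hy.coeff_mem _ (h0 ▸ zero_mem _) 1
    rw [coeff_sub, coeff_mul_X, coeff_C_mul, coeff_C_mul, hrB, mul_zero, sub_zero] at h1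
    exact (hM.isPrime.mem_or_mem h1).resolve_left ht
  -- The cubic term is split off so that the cofactor of X² has no linear term and its value at y
  -- stays in `T`.
  have hdec : p = C (p.coeff 0) + X ^ 2 * (p.divX.divX - C (p.divX.divX.coeff 1) * X) +
      X ^ 3 * C (p.divX.divX.coeff 1) := by
    have h1 := p.divX_mul_X_add
    have h2 := p.divX.divX_mul_X_add
    have h3 : p.divX.coeff 0 = 0 := by rw [coeff_divX]; exact hpB
    rw [h3, map_zero, add_zero] at h2
    conv_lhs => rw [← h1, ← h2]
    ring
  have hd : p.divX.divX - C (p.divX.divX.coeff 1) * X ∈ noLinearTerm R := by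
    rw [mem_noLinearTerm, coeff_sub, coeff_C_mul, coeff_X_one, mul_one, sub_self]
  have hsu : algebraMap R T s * u = algebraMap R T (p.coeff 0) +
      y2 * ⟨_, aeval_mem_localizedValues hd⟩ + y3 * algebraMap R T (p.divX.divX.coeff 1) := by
    apply Subtype.ext
    change algebraMap R K s * (u : K) = algebraMap R K (p.coeff 0) +
      y ^ 2 * aeval y _ + y ^ 3 * algebraMap R K (p.divX.divX.coeff 1)
    rw [hp]
    conv_lhs => rw [hdec]
    simp only [map_add, map_mul, map_pow, aeval_X, aeval_C]
  have hsQ : algebraMap R T s ∉ Q := fun hsQ => hs (hQM ▸ hsQ)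
  refine hu ((hQ.isPrime.mem_or_mem (?_ : algebraMap R T s * u ∈ Q)).resolve_left hsQ)
  rw [hsu]
  refine add_mem (add_mem ?_ (Q.mul_mem_right _ hy2)) (Q.mul_mem_right _ hy3)
  exact hmQ _ (algebraMap_mem_maxLoc.2 hp0)

theorem integralMultiplierRings_of_isLPVD (h : IsLPVD R)
    (hT : ∀ T : Subalgebra R K, IsLPVD T) : IntegralMultiplierRings R K := by
  by_contra hc
  obtain ⟨M, hM, y, hy⟩ := exists_residuallyTranscendental hc
  exact hy.not_isLPVD (h.stronglyPrimeAt M) (hT _)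

open Polynomial in
-- The kernel of evaluation at y is a prime strictly between 0 and M R[X].
theorem ResiduallyTranscendental.two_le_height {M : Ideal R} [hM : M.IsPrime] {y : K}
    (hy : ResiduallyTranscendental M y) : 2 ≤ (M.map (C : R →+* R[X])).height := by
  let U : Ideal R[X] := RingHom.ker (aeval y : R[X] →ₐ[R] K)
  have hU : U.IsPrime := RingHom.ker_isPrime _
  have h1 : (⊥ : Ideal R[X]) < U := by
    obtain ⟨a, b, hb, hab⟩ := IsFractionRing.div_surjective (A := R) y
    have hb0 := nonZeroDivisors.ne_zero hb
    have hb0' : algebraMap R K b ≠ 0 := by simpa using hb0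
    refine bot_lt_iff_ne_bot.2 fun h0 => hb0 ?_
    have : C b * X - C a ∈ U := by
      rw [RingHom.mem_ker, map_sub, map_mul, aeval_C, aeval_C, aeval_X, ← hab,
        mul_div_cancel₀ _ hb0', sub_self]
    rw [h0, Ideal.mem_bot] at this
    simpa using congrArg (fun p => coeff p 1) this
  have h2 : U < M.map (C : R →+* R[X]) := by
    refine lt_of_le_of_ne (fun f hf => ?_) fun heq => ?_
    · rw [Ideal.mem_map_C_iff]
      exact fun n => hy.coeff_mem f ((RingHom.mem_ker.1 hf).symm ▸ zero_mem _) n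
    · obtain ⟨m, hm, hm0⟩ := Submodule.exists_mem_ne_zero_of_ne_bot hy.ne_bot
      have : C m ∈ U := heq ▸ Ideal.mem_map_of_mem _ hm
      rw [RingHom.mem_ker, aeval_C, FaithfulSMul.algebraMap_eq_zero_iff] at this
      exact hm0 this
  have h3 := Ideal.height_add_one_le_of_lt_of_isPrime h1
  have h4 := Ideal.height_add_one_le_of_lt_of_isPrime h2
  rw [Ideal.height_bot, zero_add] at h3
  calc (2 : ℕ∞) = 1 + 1 := by norm_num
    _ ≤ U.height + 1 := by gcongr
    _ ≤ _ := h4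

end ResiduallyTranscendental

/-! ### Dimension of polynomial rings and the strong S-property. -/

section Dimension

open Polynomial

/-- The prime P A[X] is strictly contained in the prime generated by P and X. -/
lemma height_map_C_add_one_le_ringKrullDim {A : Type*} [CommRing A] (P : Ideal A)
    [hP : P.IsPrime] : ((P.map (C : A →+* A[X])).height + 1 : ℕ∞) ≤ ringKrullDim A[X] := by
  let Q : Ideal A[X] := P.comap constantCoeff
  have hQ : Q.IsPrime := hP.comap _
  have hlt : P.map (C : A →+* A[X]) < Q := by
    refine lt_of_le_of_ne ?_ fun heq => ?_
    · rw [Ideal.map_le_iff_le_comap]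
      intro a ha
      simpa [Q] using ha
    · have hX : (X : A[X]) ∈ Q := by simp [Q]
      rw [← heq, Ideal.mem_map_C_iff] at hX
      exact hP.ne_top ((Ideal.eq_top_iff_one P).2 (by simpa using hX 1))
  exact le_trans (WithBot.coe_le_coe.2 (Ideal.height_add_one_le_of_lt_of_isPrime hlt))
    Ideal.height_le_ringKrullDim_of_isPrime

lemma isSDomain_of_ringKrullDim_le {A : Type*} [CommRing A] [IsDomain A]
    (h : ringKrullDim A[X] ≤ 2) : IsSDomain A := by
  refine ⟨inferInstance, fun P hP hP1 => ⟨inferInstance, le_antisymm ?_ ?_⟩⟩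
  · have h1 := (height_map_C_add_one_le_ringKrullDim P).trans h
    have h2 : (P.map (C : A →+* A[X])).height + 1 ≤ 1 + 1 := by
      rw [one_add_one_eq_two]
      exact WithBot.coe_le_coe.1 h1
    exact (ENat.add_le_add_iff_right ENat.one_ne_top).1 h2
  · rw [Order.one_le_iff_ne_zero, Ne, Ideal.height_eq_zero_iff_eq_bot,
      Ideal.map_eq_bot_iff_of_injective C_injective]
    exact Ideal.ne_bot_of_height_eq_one hP1

lemma isStrongSRing_of_ringKrullDim_le {A : Type*} [CommRing A]
    (h : ringKrullDim A[X] ≤ 2) : IsStrongSRing A := fun N _ =>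
  isSDomain_of_ringKrullDim_le ((ringKrullDim_le_of_surjective
    (mapRingHom (Ideal.Quotient.mk N))
    (map_surjective _ Ideal.Quotient.mk_surjective)).trans h)

lemma IsStrongSRing.height_map_C {A : Type*} [CommRing A] [IsDomain A] (h : IsStrongSRing A)
    {P : Ideal A} [hP : P.IsPrime] (hP1 : P.height = 1) :
    (P.map (C : A →+* A[X])).height = 1 := by
  let e : A ⧸ (⊥ : Ideal A) ≃+* A := RingEquiv.quotientBot A
  have h1 := ((h ⊥ Ideal.isPrime_bot).2 (P.comap e) (Ideal.comap_isPrime e P) (by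
    rw [RingEquiv.height_comap, hP1])).2
  rw [← h1, ← RingEquiv.height_comap (mapEquiv e)]
  congr 1
  ext f
  rw [Ideal.mem_comap, Ideal.mem_map_C_iff, Ideal.mem_map_C_iff]
  simp [Ideal.mem_comap]

/-- Lying over and going up lift a chain of primes below `P` to `B`. -/
lemma exists_prime_over_height_le {A B : Type*} [CommRing A] [CommRing B] [Algebra A B]
    [FaithfulSMul A B] [Algebra.IsIntegral A B] (n : ℕ) (P : Ideal A) [hP : P.IsPrime]
    (hn : n ≤ P.height) :
    ∃ Q : Ideal B, Q.IsPrime ∧ Q.comap (algebraMap A B) = P ∧ n ≤ Q.height := by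
  induction n generalizing P with
  | zero =>
    obtain ⟨Q, -, hQ, hQP⟩ := Ideal.exists_ideal_over_prime_of_isIntegral (S := B) P ⊥ (by
      rw [← RingHom.ker_eq_comap_bot,
        (RingHom.injective_iff_ker_eq_bot _).1 (FaithfulSMul.algebraMap_injective A B)]
      exact bot_le)
    exact ⟨Q, hQ, hQP, by simp⟩
  | succ n ih =>
    obtain ⟨P', hP', hlt, hn'⟩ : ∃ P' : Ideal A, P'.IsPrime ∧ P' < P ∧ n ≤ P'.height := by
      by_contra hc
      push Not at hc
      have := Ideal.height_le_iff.2 hc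
      exact absurd (hn.trans this) (by
        rw [not_le]
        exact_mod_cast n.lt_succ_self)
    obtain ⟨Q', hQ', hQP', hnQ⟩ := ih P' hn'
    obtain ⟨Q, hle, hQ, hQP⟩ := Ideal.exists_ideal_over_prime_of_isIntegral P Q'
      (hQP' ▸ hlt.le)
    refine ⟨Q, hQ, hQP, ?_⟩
    have hQlt : Q' < Q := lt_of_le_of_ne hle fun heq => hlt.ne (by rw [← hQP', ← hQP, heq])
    push_cast
    exact (by gcongr : (n : ℕ∞) + 1 ≤ Q'.height + 1).trans
      (Ideal.height_add_one_le_of_lt_of_isPrime hQlt)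

lemma ringKrullDim_le_of_isIntegral {A B : Type*} [CommRing A] [CommRing B] [Algebra A B]
    [FaithfulSMul A B] [Algebra.IsIntegral A B] {n : ℕ} (h : ringKrullDim B ≤ n) :
    ringKrullDim A ≤ n := by
  rw [ringKrullDim_le_iff_height_le]
  intro P hP
  by_contra hc
  have hn : ((n + 1 : ℕ) : ℕ∞) ≤ P.height := by
    have : (n : ℕ∞) < P.height := by
      rw [not_le] at hc
      exact_mod_cast hc
    simpa using Order.add_one_le_of_lt this
  obtain ⟨Q, hQ, -, hQn⟩ := exists_prime_over_height_le (B := B) (n + 1) P hn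
  have h1 := (ringKrullDim_le_iff_height_le _).1 h hQ
  have h2 : Q.height ≤ (n : ℕ∞) := by exact_mod_cast h1
  exact absurd (hQn.trans h2) (by
    rw [not_le]
    exact_mod_cast n.lt_succ_self)

variable {R : Type*} [CommRing R] [IsDomain R]
variable {K : Type*} [Field K] [Algebra R K] [IsFractionRing R K]

attribute [local instance] Polynomial.algebra in
-- R'[X] is integral over R[X], and R' is Noetherian, so dim R'[X] = dim R' + 1.
theorem ringKrullDim_polynomial_le_two (h : IsDedekindDomain (integralClosure R K)) :
    ringKrullDim R[X] ≤ 2 := by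
  have h1 : ringKrullDim (integralClosure R K)[X] ≤ 2 := by
    rw [Polynomial.ringKrullDim_of_isNoetherianRing]
    have : ringKrullDim (integralClosure R K) ≤ 1 := Ring.krullDimLE_iff.1 inferInstance
    calc _ ≤ (1 : WithBot ℕ∞) + 1 := by gcongr
      _ = 2 := one_add_one_eq_two
  have : FaithfulSMul R[X] (integralClosure R K)[X] := by
    rw [faithfulSMul_iff_algebraMap_injective]
    exact map_injective _ (FaithfulSMul.algebraMap_injective R (integralClosure R K))
  exact ringKrullDim_le_of_isIntegral (n := 2) (A := R[X]) (B := (integralClosure R K)[X]) h1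

theorem integralMultiplierRings_of_isStrongSRing (hR : IsMoriDomain R) (h : IsLPVD R)
    (hS : IsStrongSRing R) : IntegralMultiplierRings R K := by
  by_contra hc
  obtain ⟨M, hM, y, hy⟩ := exists_residuallyTranscendental hc
  have hM1 : M.height = 1 := by
    refine le_antisymm ?_ ?_
    · refine Ideal.height_le_iff.2 fun P hP hlt => ?_
      have : P = ⊥ := by
        by_contra hP0
        exact hlt.ne ((hR.isMaximal h hP hP0).eq_of_le hM.ne_top hlt.le)
      rw [this, Ideal.height_bot]
      exact one_pos
    · rw [Order.one_le_iff_ne_zero, Ne, Ideal.height_eq_zero_iff_eq_bot]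
      exact hy.ne_bot
  have h2 := hy.two_le_height
  rw [hS.height_map_C hM1] at h2
  exact absurd h2 (by norm_num)

end Dimension

/-! ### The equivalences, assembled around R' = R*. -/

theorem corollary3p9 {R : Type*} [CommRing R] [IsDomain R]
    {K : Type*} [Field K] [Algebra R K] [IsFractionRing R K]
    (hMori : IsMoriDomain R) (hLPVD : IsLPVD R) :
    List.TFAE [
      ∀ T : Subalgebra R K, IsMoriDomain T ∧ IsLPVD T,
      ∀ T : Subalgebra R K, IsMoriDomain T,
      ∀ T : Subalgebra R K, IsLPVD T,
      integralClosure R K = completeIntegralClosure R K,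
      IsDedekindDomain (integralClosure R K),
      IsPruferDomain (integralClosure R K),
      IsKrullDomain (integralClosure R K),
      IsIDomain R K,
      IsStrongSRing R,
      ringKrullDim R[X] ≤ 2] := by
  have hiff := integralClosure_eq_completeIntegralClosure_iff (K := K) hMori hLPVD
  tfae_have 1 → 2 := fun h T => (h T).1
  tfae_have 1 → 3 := fun h T => (h T).2
  tfae_have 2 → 4 := fun h => hiff.2 (integralMultiplierRings_of_isMoriDomain hLPVD h)
  tfae_have 3 → 4 := fun h => hiff.2 (integralMultiplierRings_of_isLPVD hLPVD h)
  tfae_have 4 → 1 := fun h T =>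
    ⟨(hiff.1 h).isMoriDomain hMori hLPVD T, (hiff.1 h).isLPVD hMori hLPVD T⟩
  tfae_have 4 → 5 := fun h => (hiff.1 h).isDedekindDomain hMori hLPVD
  tfae_have 5 → 6 := fun _ => IsDedekindDomain.isPruferDomain
  tfae_have 5 → 7 := fun _ => IsDedekindDomain.isKrullDomain
  tfae_have 5 → 10 := ringKrullDim_polynomial_le_two
  tfae_have 6 → 4 := fun h => hiff.2 (integralMultiplierRings_of_isPruferDomain hMori hLPVD h)
  tfae_have 7 → 4 := integralClosure_eq_of_isKrullDomain
  tfae_have 4 → 8 := fun h => (hiff.1 h).isIDomain hMori hLPVD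
  tfae_have 8 → 4 := fun h => hiff.2 (integralMultiplierRings_of_isIDomain hLPVD h)
  tfae_have 10 → 9 := isStrongSRing_of_ringKrullDim_le
  tfae_have 9 → 4 := fun h => hiff.2 (integralMultiplierRings_of_isStrongSRing hMori hLPVD h)
  tfae_finish
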